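/- Let $a,b,\alpha>0$ and $\xi\in(0,1)$; all functions are complex-valued. Let $\mathcal H=[H^2(0,1)\cap H^1_0(0,1)]\times L^2(0,1)$ be equipped with the inner product $$(U_1,U_2)_{\mathcal H}=\int_0^1\big(a\,u_{1,xx}\,\overline{u_{2,xx}}+v_1\,\overline{v_2}\big)\,dx,\qquad U_i=(u_i,v_i).$$ Let $D(\mathcal A)$ be the set of all $U=(u,v)\in\mathcal H$ such that $u\in H^4(0,\xi)\cap H^4(\xi,1)\cap H^2(0,1)$, $v\in H^2(0,1)$, $u(0)=u(1)=v(0)=v(1)=0$, $u_{xx}(0)=u_{xx}(1)=0$, $u_{xx}(\xi^-)=u_{xx}(\xi^+)$ and $$u_{xxx}(\xi^+)-u_{xxx}(\xi^-)=-\frac{\alpha}{a}\,v(\xi),$$ and let $\mathcal A:D(\mathcal A)\to\mathcal H$ be the linear operator $$\mathcal A(u,v)=\big(v,\;-a\,u_{xxxx}-b\,v-\alpha\,v(\xi)\,\delta_\xi\big),$$ where the second component is understood as a distribution on $(0,1)$ (it belongs to $L^2(0,1)$ for $(u,v)\in D(\mathcal A)$, because of the jump condition at $\xi$). Then $\mathcal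 A$ is m-dissipative in $\mathcal H$, that is, $\operatorname{Re}(\mathcal AU,U)_{\mathcal H}\le 0$ for all $U\in D(\mathcal A)$, and $\mu I-\mathcal A:D(\mathcal A)\to\mathcal H$ is surjective for every $\mu>0$. More precisely, for every $U=(u,v)\in D(\mathcal A)$, $$\operatorname{Re}(\mathcal AU,U)_{\mathcal H}=-b\int_0^1|v(x)|^2\,dx-\alpha\,|v(\xi)|^2,$$ and $-\mathcal A:D(\mathcal A)\to\mathcal H$ is surjective. -/

import Mathlib

open MeasureTheory Set Filter
open scoped ContDiff

noncomputable section

namespace Beam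

/-- Real test functions on the open interval `(c, d)`. -/
def IsTest (c d : ℝ) (φ : ℝ → ℝ) : Prop :=
  ContDiff ℝ ∞ φ ∧ HasCompactSupport φ ∧ tsupport φ ⊆ Ioo c d

/-- `g` is a weak (distributional) derivative of order `k` of `f` on `(c, d)`. -/
def IsWeakDeriv (c d : ℝ) (k : ℕ) (f g : ℝ → ℂ) : Prop :=
  ∀ φ : ℝ → ℝ, IsTest c d φ →
    ∫ x in Ioo c d, iteratedDeriv k φ x • f x = (-1) ^ k * ∫ x in Ioo c d, φ x • g x

/-- The complex Lebesgue space `L²(c, d)`. -/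
abbrev L2 (c d : ℝ) : Type := Lp ℂ 2 (volume.restrict (Ioo c d))

theorem IsTest.test_deriv {c d : ℝ} {φ : ℝ → ℝ} (h : IsTest c d φ) : IsTest c d (deriv φ) :=
  ⟨(contDiff_infty_iff_deriv.1 h.1).2, h.2.1.deriv, (tsupport_deriv_subset).trans h.2.2⟩

theorem IsTest.test_iteratedDeriv {c d : ℝ} {φ : ℝ → ℝ} (h : IsTest c d φ) (k : ℕ) :
    IsTest c d (iteratedDeriv k φ) := by
  induction k with
  | zero => simpa using h
  | succ k ih => rw [iteratedDeriv_succ]; exact ih.test_deriv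

theorem IsTest.mono {c d c' d' : ℝ} {φ : ℝ → ℝ} (h : IsTest c d φ) (h1 : c' ≤ c) (h2 : d ≤ d') :
    IsTest c' d' φ := ⟨h.1, h.2.1, h.2.2.trans (Ioo_subset_Ioo h1 h2)⟩

theorem IsTest.eq_zero {c d : ℝ} {φ : ℝ → ℝ} (h : IsTest c d φ) {x : ℝ} (hx : x ∉ Ioo c d) :
    φ x = 0 := image_eq_zero_of_notMem_tsupport fun h' => hx (h.2.2 h')

theorem memLp_integrableOn {c d : ℝ} {f : ℝ → ℂ} (h : MemLp f 2 (volume.restrict (Ioo c d))) :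
    IntegrableOn f (Ioo c d) := h.integrable (by norm_num)

theorem L2.integrableOn {c d : ℝ} (f : L2 c d) : IntegrableOn f (Ioo c d) :=
  memLp_integrableOn (Lp.memLp f)

theorem IsTest.integrable_smul {c d : ℝ} {φ : ℝ → ℝ} (h : IsTest c d φ) {c' d' : ℝ} {f : ℝ → ℂ}
    (hf : IntegrableOn f (Ioo c' d')) :
    Integrable (fun x => φ x • f x) (volume.restrict (Ioo c' d')) := by
  obtain ⟨C, hC⟩ := h.2.1.exists_bound_of_continuous h.1.continuous
  exact Integrable.bdd_smul (C := C) hf h.1.continuous.aestronglyMeasurable (ae_of_all _ hC)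

/-- The fundamental lemma of the calculus of variations on an interval. -/
theorem ae_eq_of_test {c d : ℝ} {f g : ℝ → ℂ} (hf : IntegrableOn f (Ioo c d))
    (hg : IntegrableOn g (Ioo c d))
    (h : ∀ φ : ℝ → ℝ, IsTest c d φ →
      ∫ x in Ioo c d, φ x • f x = ∫ x in Ioo c d, φ x • g x) :
    f =ᵐ[volume.restrict (Ioo c d)] g := by
  have key := isOpen_Ioo.ae_eq_zero_of_integral_contDiff_smul_eq_zero (U := Ioo c d)
    (f := fun x => f x - g x) (μ := volume) (hf.sub hg).locallyIntegrableOn (by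
      intro φ h1 h2 h3
      have hφ : IsTest c d φ := ⟨h1, h2, h3⟩
      rw [← setIntegral_eq_integral_of_forall_compl_eq_zero (s := Ioo c d)
        (fun x hx => by rw [hφ.eq_zero hx, zero_smul])]
      simp only [smul_sub]
      rw [integral_sub (hφ.integrable_smul hf) (hφ.integrable_smul hg), h φ hφ, sub_self])
  rw [EventuallyEq, ae_restrict_iff' measurableSet_Ioo]
  filter_upwards [key] with x hx hx'
  exact sub_eq_zero.1 (hx hx')

theorem IsWeakDeriv.congr_left {c d : ℝ} {k : ℕ} {f f' g : ℝ → ℂ} (h : IsWeakDeriv c d k f g)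
    (hf : f =ᵐ[volume.restrict (Ioo c d)] f') : IsWeakDeriv c d k f' g := by
  intro φ hφ
  rw [← h φ hφ]
  exact integral_congr_ae (hf.mono fun x hx => by simp only [hx])

theorem IsWeakDeriv.congr_right {c d : ℝ} {k : ℕ} {f g g' : ℝ → ℂ} (h : IsWeakDeriv c d k f g)
    (hg : g =ᵐ[volume.restrict (Ioo c d)] g') : IsWeakDeriv c d k f g' := by
  intro φ hφ
  rw [h φ hφ]
  congr 1
  exact integral_congr_ae (hg.mono fun x hx => by simp only [hx])

theorem IsWeakDeriv.unique {c d : ℝ} {k : ℕ} {f g g' : ℝ → ℂ} (h : IsWeakDeriv c d k f g)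
    (h' : IsWeakDeriv c d k f g') (hg : IntegrableOn g (Ioo c d))
    (hg' : IntegrableOn g' (Ioo c d)) : g =ᵐ[volume.restrict (Ioo c d)] g' := by
  refine ae_eq_of_test hg hg' fun φ hφ => ?_
  have := (h φ hφ).symm.trans (h' φ hφ)
  exact mul_left_cancel₀ (pow_ne_zero _ (by norm_num)) this

theorem IsWeakDeriv.add {c d : ℝ} {k : ℕ} {f g f' g' : ℝ → ℂ} (h : IsWeakDeriv c d k f g)
    (h' : IsWeakDeriv c d k f' g') (hf : IntegrableOn f (Ioo c d))
    (hf' : IntegrableOn f' (Ioo c d)) (hg : IntegrableOn g (Ioo c d))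
    (hg' : IntegrableOn g' (Ioo c d)) :
    IsWeakDeriv c d k (fun x => f x + f' x) (fun x => g x + g' x) := by
  intro φ hφ
  have hk := hφ.test_iteratedDeriv k
  simp only [smul_add]
  rw [integral_add (hk.integrable_smul hf) (hk.integrable_smul hf'),
    integral_add (hφ.integrable_smul hg) (hφ.integrable_smul hg'), h φ hφ, h' φ hφ, mul_add]

theorem IsWeakDeriv.smul {c d : ℝ} {k : ℕ} {f g : ℝ → ℂ} (h : IsWeakDeriv c d k f g) (r : ℂ) :
    IsWeakDeriv c d k (fun x => r • f x) (fun x => r • g x) := by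
  intro φ hφ
  simp only [smul_comm _ r]
  rw [integral_smul, integral_smul, h φ hφ, smul_eq_mul, smul_eq_mul]
  ring

theorem IsWeakDeriv.mono {c d c' d' : ℝ} {k : ℕ} {f g : ℝ → ℂ} (h : IsWeakDeriv c d k f g)
    (h1 : c ≤ c') (h2 : d' ≤ d) : IsWeakDeriv c' d' k f g := by
  intro φ hφ
  have hk := hφ.test_iteratedDeriv k
  have e := h φ (hφ.mono h1 h2)
  rwa [setIntegral_eq_of_subset_of_forall_sdiff_eq_zero measurableSet_Ioo (Ioo_subset_Ioo h1 h2)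
      (fun x hx => by rw [hk.eq_zero hx.2, zero_smul]),
    setIntegral_eq_of_subset_of_forall_sdiff_eq_zero measurableSet_Ioo (Ioo_subset_Ioo h1 h2)
      (fun x hx => by rw [hφ.eq_zero hx.2, zero_smul])] at e

/-- If `g₁`, `g₂` are weak derivatives of orders `k`, `k + 1`, then `g₂` is that of `g₁`. -/
theorem IsWeakDeriv.step {c d : ℝ} {k : ℕ} {f g₁ g₂ : ℝ → ℂ} (h₁ : IsWeakDeriv c d k f g₁)
    (h₂ : IsWeakDeriv c d (k + 1) f g₂) : IsWeakDeriv c d 1 g₁ g₂ := by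
  intro φ hφ
  have e₁ := h₁ _ hφ.test_deriv
  rw [← iteratedDeriv_succ', h₂ φ hφ] at e₁
  rw [iteratedDeriv_one]
  have : ((-1 : ℂ) ^ k) ≠ 0 := pow_ne_zero _ (by norm_num)
  apply mul_left_cancel₀ this
  rw [← e₁]; ring

/-- Integration by parts of a smooth function against a primitive. -/
theorem ibp_real {c d : ℝ} {φ g : ℝ → ℝ} (hφ : ContDiff ℝ ∞ φ)
    (hg : IntervalIntegrable g volume c d) :
    ∫ x in c..d, deriv φ x * (∫ t in c..x, g t) =
      φ d * (∫ t in c..d, g t) - ∫ x in c..d, φ x * g x := by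
  have h1 : AbsolutelyContinuousOnInterval φ c d :=
    (hφ.of_le (by exact_mod_cast le_top)).contDiffOn.absolutelyContinuousOnInterval
  have h2 := hg.absolutelyContinuousOnInterval_intervalIntegral (c := c) (by simp)
  have e := h1.integral_mul_deriv_eq_deriv_mul h2
  have e2 : ∫ x in c..d, φ x * deriv (fun x => ∫ t in c..x, g t) x = ∫ x in c..d, φ x * g x := by
    apply intervalIntegral.integral_congr_ae
    filter_upwards [hg.ae_hasDerivAt_integral] with x hx hx'
    rw [(hx (uIoc_subset_uIcc hx') c (by simp)).deriv]
  rw [e2] at e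
  simp only [intervalIntegral.integral_same, mul_zero, sub_zero] at e
  linarith

theorem ibp {c d : ℝ} {φ : ℝ → ℝ} {g : ℝ → ℂ} (hφ : ContDiff ℝ ∞ φ)
    (hg : IntervalIntegrable g volume c d) :
    ∫ x in c..d, deriv φ x • (∫ t in c..x, g t) =
      φ d • (∫ t in c..d, g t) - ∫ x in c..d, φ x • g x := by
  have hsub : ∀ x ∈ uIcc c d, IntervalIntegrable g volume c x := fun x hx =>
    hg.mono_set (uIcc_subset_uIcc_left hx)
  have hprim : ContinuousOn (fun x => ∫ t in c..x, g t) (uIcc c d) :=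
    intervalIntegral.continuousOn_primitive_interval' hg (by simp)
  have hd : Continuous (deriv φ) := hφ.continuous_deriv (by simp)
  have hi1 : IntervalIntegrable (fun x => deriv φ x • (∫ t in c..x, g t)) volume c d :=
    (hd.continuousOn.smul hprim).intervalIntegrable
  have hi2 : IntervalIntegrable (fun x => φ x • g x) volume c d :=
    hg.continuousOn_smul hφ.continuous.continuousOn
  have main : ∀ L : ℂ →L[ℝ] ℝ, L (∫ x in c..d, deriv φ x • (∫ t in c..x, g t)) =
      L (φ d • (∫ t in c..d, g t) - ∫ x in c..d, φ x • g x) := by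
    intro L
    have hL : IntervalIntegrable (fun x => L (g x)) volume c d :=
      ⟨L.integrable_comp hg.1, L.integrable_comp hg.2⟩
    rw [map_sub, ← L.intervalIntegral_comp_comm hi1, ← L.intervalIntegral_comp_comm hi2,
      map_smul, ← L.intervalIntegral_comp_comm hg]
    simp only [map_smul, smul_eq_mul]
    rw [← ibp_real hφ hL]
    apply intervalIntegral.integral_congr
    intro x hx
    simp only
    rw [L.intervalIntegral_comp_comm (hsub x hx)]
  exact Complex.ext (main Complex.reCLM) (main Complex.imCLM)

theorem setIntegral_Ioo {c d : ℝ} (hcd : c ≤ d) (f : ℝ → ℂ) :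
    ∫ x in Ioo c d, f x = ∫ x in c..d, f x := by
  rw [intervalIntegral.integral_of_le hcd, integral_Ioc_eq_integral_Ioo]

theorem intervalIntegrable_of_Ioo {c d : ℝ} (hcd : c ≤ d) {f : ℝ → ℂ}
    (hf : IntegrableOn f (Ioo c d)) : IntervalIntegrable f volume c d :=
  (intervalIntegrable_iff_integrableOn_Ioo_of_le hcd).2 hf

theorem exists_test_integral_one {c d : ℝ} (hcd : c < d) :
    ∃ ψ : ℝ → ℝ, IsTest c d ψ ∧ ∫ x in c..d, ψ x = 1 := by
  let B : ContDiffBump ((c + d) / 2) :=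
    ⟨(d - c) / 8, (d - c) / 4, by linarith, by linarith⟩
  have hT : IsTest c d (B.normed volume) := by
    refine ⟨B.contDiff_normed, B.hasCompactSupport_normed, ?_⟩
    rw [B.tsupport_normed_eq, Real.closedBall_eq_Icc]
    intro x hx
    simp only [B, mem_Icc, mem_Ioo] at hx ⊢
    constructor <;> linarith [hx.1, hx.2]
  refine ⟨_, hT, ?_⟩
  rw [intervalIntegral.integral_of_le hcd.le, integral_Ioc_eq_integral_Ioo,
    setIntegral_eq_integral_of_forall_compl_eq_zero fun x hx => hT.eq_zero hx]
  exact B.integral_normed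

theorem IsTest.primitive {c d : ℝ} {φ : ℝ → ℝ} (hφ : IsTest c d φ)
    (h0 : ∫ x in c..d, φ x = 0) :
    ∃ Φ : ℝ → ℝ, IsTest c d Φ ∧ deriv Φ = φ := by
  have hder : ∀ x, HasDerivAt (fun x => ∫ t in c..x, φ t) (φ x) x := fun x =>
    intervalIntegral.integral_hasDerivAt_right (hφ.1.continuous.intervalIntegrable _ _)
      (hφ.1.continuous.stronglyMeasurableAtFilter _ _) hφ.1.continuous.continuousAt
  have hd : deriv (fun x => ∫ t in c..x, φ t) = φ := funext fun x => (hder x).deriv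
  refine ⟨fun x => ∫ t in c..x, φ t, ?_, hd⟩
  have hsm : ContDiff ℝ ∞ (fun x => ∫ t in c..x, φ t) :=
    contDiff_infty_iff_deriv.2 ⟨fun x => (hder x).differentiableAt, by rw [hd]; exact hφ.1⟩
  by_cases hne : (tsupport φ).Nonempty
  · have hK : IsCompact (tsupport φ) := hφ.2.1
    have h1 := hφ.2.2 (hK.sInf_mem hne)
    have h2 := hφ.2.2 (hK.sSup_mem hne)
    have hsub : tsupport (fun x => ∫ t in c..x, φ t) ⊆
        Icc (sInf (tsupport φ)) (sSup (tsupport φ)) := by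
      refine closure_minimal ?_ isClosed_Icc
      intro x hx
      by_contra hx'
      apply hx
      rw [mem_Icc, not_and_or, not_le, not_le] at hx'
      rcases hx' with hx' | hx'
      · have : EqOn φ (fun _ => 0) (uIcc c x) := by
          intro t ht
          apply image_eq_zero_of_notMem_tsupport
          intro ht'
          have := csInf_le hK.bddBelow ht'
          have h3 : t ≤ max c x := ht.2
          have := h1.1
          rcases le_max_iff.1 h3 with h | h <;> linarith
        simp only
        rw [intervalIntegral.integral_congr this]
        simp
      · have : EqOn φ (fun _ => 0) (uIcc d x) := by
          intro t ht
          apply image_eq_zero_of_notMem_tsupport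
          intro ht'
          have := le_csSup hK.bddAbove ht'
          have h3 : min d x ≤ t := ht.1
          have := h2.2
          rcases min_le_iff.1 h3 with h | h <;> linarith
        simp only
        rw [← intervalIntegral.integral_add_adjacent_intervals
          (hφ.1.continuous.intervalIntegrable c d) (hφ.1.continuous.intervalIntegrable d x),
          h0, intervalIntegral.integral_congr this]
        simp
    exact ⟨hsm, isCompact_Icc.of_isClosed_subset (isClosed_tsupport _) hsub,
      hsub.trans fun x hx => ⟨h1.1.trans_le hx.1, hx.2.trans_lt h2.2⟩⟩
  · have hz : φ = 0 := by
      rw [not_nonempty_iff_eq_empty, tsupport_eq_empty_iff] at hne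
      exact hne
    have : (fun x => ∫ t in c..x, φ t) = fun _ => (0 : ℝ) := by
      funext x; simp [hz]
    rw [this]
    refine ⟨contDiff_const, HasCompactSupport.zero, ?_⟩
    have : tsupport (fun _ : ℝ => (0 : ℝ)) = ∅ := tsupport_eq_empty_iff.2 rfl
    rw [this]; exact empty_subset _

/-- Du Bois-Reymond: a function with zero weak derivative is constant. -/
theorem ae_const_of_weakDeriv_zero {c d : ℝ} (hcd : c < d) {h : ℝ → ℂ}
    (hh : IntegrableOn h (Ioo c d))
    (h0 : ∀ φ : ℝ → ℝ, IsTest c d φ → ∫ x in Ioo c d, deriv φ x • h x = 0) :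
    ∃ C : ℂ, h =ᵐ[volume.restrict (Ioo c d)] fun _ => C := by
  obtain ⟨ψ, hψ, hψ1⟩ := exists_test_integral_one hcd
  refine ⟨∫ x in Ioo c d, ψ x • h x, ae_eq_of_test hh (by simp) fun φ hφ => ?_⟩
  set m := ∫ x in c..d, φ x with hm
  have hT : IsTest c d (fun x => φ x - m * ψ x) := by
    have e : (fun x => φ x - m * ψ x) = φ - fun x => m * ψ x := rfl
    refine ⟨hφ.1.sub (contDiff_const.mul hψ.1), ?_, ?_⟩
    · rw [e, sub_eq_add_neg]
      exact hφ.2.1.add (hψ.2.1.mul_left.neg)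
    · rw [e]
      refine (tsupport_sub _ _).trans (union_subset hφ.2.2 (Subset.trans ?_ hψ.2.2))
      exact tsupport_mul_subset_right
  obtain ⟨Φ, hΦ, hΦ'⟩ := hT.primitive (by
    rw [intervalIntegral.integral_sub (hφ.1.continuous.intervalIntegrable _ _)
      ((hψ.1.continuous.const_mul m).intervalIntegrable _ _),
      intervalIntegral.integral_const_mul, hψ1]
    simp [hm])
  have key := h0 Φ hΦ
  rw [hΦ'] at key
  have e : ∀ x, (φ x - m * ψ x) • h x = φ x • h x - m • (ψ x • h x) := fun x => by
    rw [sub_smul, mul_smul]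
  simp only [e] at key
  have i2 : Integrable (fun x => m • (ψ x • h x)) (volume.restrict (Ioo c d)) :=
    (hψ.integrable_smul hh).smul m
  rw [integral_sub (hφ.integrable_smul hh) i2, integral_smul, sub_eq_zero] at key
  rw [key, integral_smul_const, hm, intervalIntegral.integral_of_le hcd.le,
    integral_Ioc_eq_integral_Ioo]

/-- A function with an integrable weak derivative is a.e. a primitive of it. -/
theorem IsWeakDeriv.exists_primitive {c d : ℝ} (hcd : c < d) {f g : ℝ → ℂ}
    (h : IsWeakDeriv c d 1 f g) (hf : IntegrableOn f (Ioo c d)) (hg : IntegrableOn g (Ioo c d)) :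
    ∃ C : ℂ, f =ᵐ[volume.restrict (Ioo c d)] fun x => C + ∫ t in c..x, g t := by
  have hgi := intervalIntegrable_of_Ioo hcd.le hg
  have hprim : ContinuousOn (fun x => ∫ t in c..x, g t) (uIcc c d) :=
    intervalIntegral.continuousOn_primitive_interval' hgi (by simp)
  have hG : IntegrableOn (fun x => ∫ t in c..x, g t) (Ioo c d) :=
    (intervalIntegrable_iff_integrableOn_Ioo_of_le hcd.le).1 hprim.intervalIntegrable
  obtain ⟨C, hC⟩ := ae_const_of_weakDeriv_zero hcd (hf.sub hG) (by
    intro φ hφ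
    have e := h φ hφ
    rw [iteratedDeriv_one, pow_one, neg_one_mul] at e
    simp only [Pi.sub_apply, smul_sub]
    rw [integral_sub (hφ.test_deriv.integrable_smul hf) (hφ.test_deriv.integrable_smul hG), e,
      setIntegral_Ioo hcd.le, setIntegral_Ioo hcd.le, ibp hφ.1 hgi,
      hφ.eq_zero (x := d) (by simp), zero_smul]
    ring)
  refine ⟨C, hC.mono fun x hx => ?_⟩
  simp only [Pi.sub_apply] at hx
  rw [← hx]; ring

/-- `f` belongs to the Sobolev space `H^m(c, d)`: `f` and its weak derivatives of orders up to `m`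
are in `L²(c, d)`. -/
def MemH (m : ℕ) (c d : ℝ) (f : ℝ → ℂ) : Prop :=
  MemLp f 2 (volume.restrict (Ioo c d)) ∧ ∀ k ≤ m, ∃ g : L2 c d, IsWeakDeriv c d k f g

open Classical in
/-- The weak derivative of order `k` of `f` on `(c, d)`, if it exists in `L²(c, d)`. -/
def weakDeriv (c d : ℝ) (k : ℕ) (f : ℝ → ℂ) : L2 c d :=
  if h : ∃ g : L2 c d, IsWeakDeriv c d k f g then h.choose else 0

/-- `f` has a representative that is continuous on `[c, d]` and takes the value `z` at `x`. -/
def HasValue (c d : ℝ) (f : ℝ → ℂ) (x : ℝ) (z : ℂ) : Prop :=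
  ∃ g : ℝ → ℂ, ContinuousOn g (Icc c d) ∧ f =ᵐ[volume.restrict (Ioo c d)] g ∧ g x = z

open Classical in
/-- The value at `x ∈ [c, d]` of the continuous representative on `[c, d]` of `f`. At `x = c` and
`x = d` it is the one-sided limit `f(c⁺)`, resp. `f(d⁻)`. -/
def value (c d : ℝ) (f : ℝ → ℂ) (x : ℝ) : ℂ :=
  if h : ∃ z, HasValue c d f x z then h.choose else 0

theorem IsWeakDeriv.weakDeriv_eq {c d : ℝ} {k : ℕ} {f : ℝ → ℂ} {g : L2 c d}
    (h : IsWeakDeriv c d k f g) : weakDeriv c d k f = g := by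
  have hex : ∃ g : L2 c d, IsWeakDeriv c d k f g := ⟨g, h⟩
  rw [weakDeriv, dif_pos hex]
  exact Lp.ext (hex.choose_spec.unique h (L2.integrableOn _) (L2.integrableOn _))

theorem MemH.isWeakDeriv {m k : ℕ} {c d : ℝ} {f : ℝ → ℂ} (h : MemH m c d f) (hk : k ≤ m) :
    IsWeakDeriv c d k f (weakDeriv c d k f) := by
  obtain ⟨g, hg⟩ := h.2 k hk
  rwa [hg.weakDeriv_eq]

theorem MemH.congr {m : ℕ} {c d : ℝ} {f f' : ℝ → ℂ} (h : MemH m c d f)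
    (hf : f =ᵐ[volume.restrict (Ioo c d)] f') : MemH m c d f' :=
  ⟨(memLp_congr_ae hf).1 h.1, fun k hk => (h.2 k hk).imp fun _ hg => hg.congr_left hf⟩

theorem weakDeriv_congr {c d : ℝ} {k : ℕ} {f f' : ℝ → ℂ}
    (hf : f =ᵐ[volume.restrict (Ioo c d)] f') : weakDeriv c d k f = weakDeriv c d k f' := by
  by_cases h : ∃ g : L2 c d, IsWeakDeriv c d k f g
  · obtain ⟨g, hg⟩ := h
    rw [hg.weakDeriv_eq, (hg.congr_left hf).weakDeriv_eq]
  · have h' : ¬ ∃ g : L2 c d, IsWeakDeriv c d k f' g := fun ⟨g, hg⟩ =>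
      h ⟨g, hg.congr_left hf.symm⟩
    rw [weakDeriv, weakDeriv, dif_neg h, dif_neg h']

theorem MemH.isWeakDeriv_add {m k : ℕ} {c d : ℝ} {f f' : ℝ → ℂ} (h : MemH m c d f)
    (h' : MemH m c d f') (hk : k ≤ m) :
    IsWeakDeriv c d k (fun x => f x + f' x) (weakDeriv c d k f + weakDeriv c d k f' : L2 c d) :=
  ((h.isWeakDeriv hk).add (h'.isWeakDeriv hk) (memLp_integrableOn h.1) (memLp_integrableOn h'.1)
    (L2.integrableOn _) (L2.integrableOn _)).congr_right (Lp.coeFn_add _ _).symm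

theorem MemH.isWeakDeriv_smul {m k : ℕ} {c d : ℝ} {f : ℝ → ℂ} (h : MemH m c d f) (r : ℂ)
    (hk : k ≤ m) : IsWeakDeriv c d k (fun x => r • f x) (r • weakDeriv c d k f : L2 c d) :=
  ((h.isWeakDeriv hk).smul r).congr_right
    (Lp.coeFn_smul r (weakDeriv c d k f)).symm

theorem MemH.add {m : ℕ} {c d : ℝ} {f f' : ℝ → ℂ} (h : MemH m c d f) (h' : MemH m c d f') :
    MemH m c d (fun x => f x + f' x) :=
  ⟨h.1.add h'.1, fun _ hk => ⟨_, h.isWeakDeriv_add h' hk⟩⟩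

theorem MemH.smul {m : ℕ} {c d : ℝ} {f : ℝ → ℂ} (h : MemH m c d f) (r : ℂ) :
    MemH m c d (fun x => r • f x) :=
  ⟨h.1.const_smul r, fun _ hk => ⟨_, h.isWeakDeriv_smul r hk⟩⟩

theorem MemH.zero {m : ℕ} {c d : ℝ} : MemH m c d (fun _ => 0) :=
  ⟨MemLp.zero, fun k _ => ⟨0, fun φ _ => by
    have : ∫ x in Ioo c d, φ x • (0 : L2 c d) x = ∫ x in Ioo c d, (0 : ℂ) :=
      integral_congr_ae ((Lp.coeFn_zero ℂ 2 _).mono fun x hx => by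
        simp only [hx, Pi.zero_apply, smul_zero])
    rw [this]; simp⟩⟩

theorem HasValue.unique {c d x : ℝ} (hcd : c < d) (hx : x ∈ Icc c d) {f : ℝ → ℂ} {z z' : ℂ}
    (h : HasValue c d f x z) (h' : HasValue c d f x z') : z = z' := by
  obtain ⟨g, hg, hfg, rfl⟩ := h
  obtain ⟨g', hg', hfg', rfl⟩ := h'
  refine Measure.eqOn_of_ae_eq (μ := volume) (X := ℝ) ?_ hg hg' ?_ hx
  · rw [← restrict_Ioo_eq_restrict_Icc]
    exact hfg.symm.trans hfg'
  · rw [interior_Icc, closure_Ioo hcd.ne]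

theorem HasValue.value_eq {c d x : ℝ} (hcd : c < d) (hx : x ∈ Icc c d) {f : ℝ → ℂ} {z : ℂ}
    (h : HasValue c d f x z) : value c d f x = z := by
  have hex : ∃ z, HasValue c d f x z := ⟨z, h⟩
  rw [value, dif_pos hex]
  exact hex.choose_spec.unique hcd hx h

theorem HasValue.add {c d x : ℝ} {f f' : ℝ → ℂ} {z z' : ℂ}
    (h : HasValue c d f x z) (h' : HasValue c d f' x z') :
    HasValue c d (fun x => f x + f' x) x (z + z') := by
  obtain ⟨g, hg, hfg, rfl⟩ := h
  obtain ⟨g', hg', hfg', rfl⟩ := h'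
  exact ⟨_, hg.add hg', hfg.add hfg', rfl⟩

theorem HasValue.smul {c d x : ℝ} {f : ℝ → ℂ} {z : ℂ} (h : HasValue c d f x z) (r : ℂ) :
    HasValue c d (fun x => r • f x) x (r • z) := by
  obtain ⟨g, hg, hfg, rfl⟩ := h
  exact ⟨_, hg.const_smul r, hfg.const_smul r, rfl⟩

theorem HasValue.zero {c d x : ℝ} : HasValue c d (fun _ => 0) x 0 :=
  ⟨_, continuousOn_const, Filter.EventuallyEq.rfl, rfl⟩

theorem HasValue.congr {c d x : ℝ} {f f' : ℝ → ℂ} {z : ℂ} (h : HasValue c d f x z)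
    (hf : f =ᵐ[volume.restrict (Ioo c d)] f') : HasValue c d f' x z := by
  obtain ⟨g, hg, hfg, rfl⟩ := h
  exact ⟨g, hg, hf.symm.trans hfg, rfl⟩

/-- Functions in `H¹(c, d)` have a continuous representative on `[c, d]`. -/
theorem hasValue_of_isWeakDeriv {c d : ℝ} (hcd : c < d) {f g : ℝ → ℂ} (h : IsWeakDeriv c d 1 f g)
    (hf : IntegrableOn f (Ioo c d)) (hg : IntegrableOn g (Ioo c d)) {x : ℝ} (hx : x ∈ Icc c d) :
    HasValue c d f x (value c d f x) := by
  obtain ⟨C, hC⟩ := h.exists_primitive hcd hf hg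
  have hcont : ContinuousOn (fun x => C + ∫ t in c..x, g t) (Icc c d) := by
    rw [← uIcc_of_le hcd.le]
    exact continuousOn_const.add (intervalIntegral.continuousOn_primitive_interval'
      (intervalIntegrable_of_Ioo hcd.le hg) (by simp))
  have hv : HasValue c d f x (C + ∫ t in c..x, g t) := ⟨_, hcont, hC, rfl⟩
  rwa [hv.value_eq hcd hx]

theorem MemH.hasValue {m : ℕ} {c d : ℝ} (hcd : c < d) {f : ℝ → ℂ} (h : MemH m c d f)
    (hm : 1 ≤ m) {x : ℝ} (hx : x ∈ Icc c d) : HasValue c d f x (value c d f x) :=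
  hasValue_of_isWeakDeriv hcd (h.isWeakDeriv hm) (memLp_integrableOn h.1) (L2.integrableOn _) hx

theorem MemH.hasValue_weakDeriv {m k : ℕ} {c d : ℝ} (hcd : c < d) {f : ℝ → ℂ} (h : MemH m c d f)
    (hk : k + 1 ≤ m) {x : ℝ} (hx : x ∈ Icc c d) :
    HasValue c d (weakDeriv c d k f) x (value c d (weakDeriv c d k f) x) :=
  hasValue_of_isWeakDeriv hcd ((h.isWeakDeriv (k.le_succ.trans hk)).step (h.isWeakDeriv hk))
    (L2.integrableOn _) (L2.integrableOn _) hx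

theorem MemH.value_add {m : ℕ} {c d : ℝ} (hcd : c < d) {f f' : ℝ → ℂ} (h : MemH m c d f)
    (h' : MemH m c d f') (hm : 1 ≤ m) {x : ℝ} (hx : x ∈ Icc c d) :
    value c d (fun x => f x + f' x) x = value c d f x + value c d f' x :=
  ((h.hasValue hcd hm hx).add (h'.hasValue hcd hm hx)).value_eq hcd hx

theorem MemH.value_smul {m : ℕ} {c d : ℝ} (hcd : c < d) {f : ℝ → ℂ} (h : MemH m c d f) (r : ℂ)
    (hm : 1 ≤ m) {x : ℝ} (hx : x ∈ Icc c d) :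
    value c d (fun x => r • f x) x = r • value c d f x :=
  ((h.hasValue hcd hm hx).smul r).value_eq hcd hx

theorem MemH.value_weakDeriv_add {m k : ℕ} {c d : ℝ} (hcd : c < d) {f f' : ℝ → ℂ}
    (h : MemH m c d f) (h' : MemH m c d f') (hk : k + 1 ≤ m) {x : ℝ} (hx : x ∈ Icc c d) :
    value c d (weakDeriv c d k (fun x => f x + f' x)) x =
      value c d (weakDeriv c d k f) x + value c d (weakDeriv c d k f') x := by
  rw [(h.isWeakDeriv_add h' (k.le_succ.trans hk)).weakDeriv_eq]
  exact (((h.hasValue_weakDeriv hcd hk hx).add (h'.hasValue_weakDeriv hcd hk hx)).congr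
    (Lp.coeFn_add _ _).symm).value_eq hcd hx

theorem MemH.value_weakDeriv_smul {m k : ℕ} {c d : ℝ} (hcd : c < d) {f : ℝ → ℂ}
    (h : MemH m c d f) (r : ℂ) (hk : k + 1 ≤ m) {x : ℝ} (hx : x ∈ Icc c d) :
    value c d (weakDeriv c d k (fun x => r • f x)) x = r • value c d (weakDeriv c d k f) x := by
  rw [(h.isWeakDeriv_smul r (k.le_succ.trans hk)).weakDeriv_eq]
  exact (((h.hasValue_weakDeriv hcd hk hx).smul r).congr
    (Lp.coeFn_smul r (weakDeriv c d k f)).symm).value_eq hcd hx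

theorem value_congr {c d x : ℝ} {f f' : ℝ → ℂ} (hf : f =ᵐ[volume.restrict (Ioo c d)] f') :
    value c d f x = value c d f' x := by
  have : HasValue c d f x = HasValue c d f' x := by
    funext z
    exact propext ⟨fun h => h.congr hf, fun h => h.congr hf.symm⟩
  classical
  exact congrArg (fun P : ℂ → Prop => if h : ∃ z, P z then h.choose else 0) this

theorem value_zero {c d x : ℝ} (hcd : c < d) (hx : x ∈ Icc c d) :
    value c d (fun _ => 0) x = 0 := HasValue.zero.value_eq hcd hx

theorem value_weakDeriv_zero {k : ℕ} {c d x : ℝ} (hcd : c < d) (hx : x ∈ Icc c d) :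
    value c d (weakDeriv c d k (fun _ => 0)) x = 0 := by
  have := (MemH.zero (m := k + 1) (c := c) (d := d)).value_weakDeriv_smul hcd 0 le_rfl hx
  simpa using this

/-- Integration by parts of a smooth function against an `H¹(c, d)` function. -/
theorem IsWeakDeriv.integral_deriv_smul {c d : ℝ} (hcd : c < d) {f g : ℝ → ℂ}
    (h : IsWeakDeriv c d 1 f g) (hf : IntegrableOn f (Ioo c d)) (hg : IntegrableOn g (Ioo c d))
    {φ : ℝ → ℝ} (hφ : ContDiff ℝ ∞ φ) :
    ∫ x in Ioo c d, deriv φ x • f x =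
      φ d • value c d f d - φ c • value c d f c - ∫ x in Ioo c d, φ x • g x := by
  obtain ⟨C, hC⟩ := h.exists_primitive hcd hf hg
  have hgi := intervalIntegrable_of_Ioo hcd.le hg
  have hprim : ContinuousOn (fun x => ∫ t in c..x, g t) (uIcc c d) :=
    intervalIntegral.continuousOn_primitive_interval' hgi (by simp)
  have hcont : ContinuousOn (fun x => C + ∫ t in c..x, g t) (Icc c d) := by
    rw [← uIcc_of_le hcd.le]
    exact continuousOn_const.add hprim
  have hv : ∀ x ∈ Icc c d, value c d f x = C + ∫ t in c..x, g t := fun x hx =>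
    HasValue.value_eq hcd hx ⟨_, hcont, hC, rfl⟩
  have hd : Continuous (deriv φ) := hφ.continuous_deriv (by simp)
  rw [hv d (by simp [hcd.le]), hv c (by simp [hcd.le]), intervalIntegral.integral_same,
    integral_congr_ae (hC.mono fun x hx => by simp only [hx] :
      (fun x => deriv φ x • f x) =ᵐ[volume.restrict (Ioo c d)]
        fun x => deriv φ x • (C + ∫ t in c..x, g t)),
    setIntegral_Ioo hcd.le, setIntegral_Ioo hcd.le]
  simp only [smul_add]
  have i1 : IntervalIntegrable (fun x => deriv φ x • C) volume c d :=
    (hd.smul continuous_const).intervalIntegrable _ _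
  have i2 : IntervalIntegrable (fun x => deriv φ x • ∫ t in c..x, g t) volume c d :=
    (hd.continuousOn.smul hprim).intervalIntegrable
  rw [intervalIntegral.integral_add i1 i2, ibp hφ hgi,
    intervalIntegral.integral_smul_const, intervalIntegral.integral_deriv_eq_sub
      (fun x _ => (hφ.differentiable (by simp)) x) (hd.intervalIntegrable _ _)]
  simp only [sub_smul, smul_zero]
  ring

theorem MemH.integral_deriv_deriv_smul {c d : ℝ} (hcd : c < d) {f : ℝ → ℂ} (h : MemH 4 c d f)
    {φ : ℝ → ℝ} (hφ : ContDiff ℝ ∞ φ) :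
    ∫ x in Ioo c d, deriv (deriv φ) x • weakDeriv c d 2 f x =
      deriv φ d • value c d (weakDeriv c d 2 f) d - deriv φ c • value c d (weakDeriv c d 2 f) c
      - (φ d • value c d (weakDeriv c d 3 f) d - φ c • value c d (weakDeriv c d 3 f) c)
      + ∫ x in Ioo c d, φ x • weakDeriv c d 4 f x := by
  have h2 := h.isWeakDeriv (k := 2) (by norm_num)
  have h3 := h.isWeakDeriv (k := 3) (by norm_num)
  have h4 := h.isWeakDeriv (k := 4) (by norm_num)
  rw [(h2.step h3).integral_deriv_smul hcd (L2.integrableOn _) (L2.integrableOn _)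
      (contDiff_infty_iff_deriv.1 hφ).2,
    (h3.step h4).integral_deriv_smul hcd (L2.integrableOn _) (L2.integrableOn _) hφ]
  ring

/-- The parameters of the beam equation
`u_tt + a u_xxxx + b u_t + α u_t(ξ, t) δ_ξ = 0` on `(0, 1)`. -/
structure Params where
  a : ℝ
  b : ℝ
  α : ℝ
  ξ : ℝ
  a_pos : 0 < a
  b_pos : 0 < b
  α_pos : 0 < α
  ξ_mem : ξ ∈ Ioo (0 : ℝ) 1

/-- `H²(0, 1) ∩ H¹₀(0, 1)` as a subspace of `L²(0, 1)`; in dimension one `H¹₀(0, 1)` consists of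
the functions in `H¹(0, 1)` that vanish at `0` and `1`. -/
def H2H10 : Submodule ℂ (L2 0 1) where
  carrier := {u | MemH 2 0 1 u ∧ value 0 1 u 0 = 0 ∧ value 0 1 u 1 = 0}
  add_mem' {u w} hu hw := by
    have e : (fun x => u x + w x) =ᵐ[volume.restrict (Ioo 0 1)] (u + w : L2 0 1) :=
      (Lp.coeFn_add u w).symm
    refine ⟨(hu.1.add hw.1).congr e, ?_, ?_⟩
    · rw [← value_congr e, hu.1.value_add zero_lt_one hw.1 (by norm_num) (by simp), hu.2.1, hw.2.1,
        add_zero]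
    · rw [← value_congr e, hu.1.value_add zero_lt_one hw.1 (by norm_num) (by simp), hu.2.2, hw.2.2,
        add_zero]
  zero_mem' := by
    have e : (fun _ => 0) =ᵐ[volume.restrict (Ioo 0 1)] (0 : L2 0 1) :=
      (Lp.coeFn_zero ℂ 2 _).symm
    refine ⟨MemH.zero.congr e, ?_, ?_⟩
    · rw [← value_congr e, value_zero zero_lt_one (by simp)]
    · rw [← value_congr e, value_zero zero_lt_one (by simp)]
  smul_mem' r u hu := by
    have e : (fun x => r • u x) =ᵐ[volume.restrict (Ioo 0 1)] (r • u : L2 0 1) :=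
      (Lp.coeFn_smul r u).symm
    refine ⟨(hu.1.smul r).congr e, ?_, ?_⟩
    · rw [← value_congr e, hu.1.value_smul zero_lt_one r (by norm_num) (by simp), hu.2.1,
        smul_zero]
    · rw [← value_congr e, hu.1.value_smul zero_lt_one r (by norm_num) (by simp), hu.2.2,
        smul_zero]

namespace Params

/-- The space `H²(0, 1) ∩ H¹₀(0, 1)`, to be equipped with the inner product `a ∫ u_xx w_xx`. -/
def Disp (_p : Params) : Type := H2H10

instance (p : Params) : AddCommGroup p.Disp := inferInstanceAs (AddCommGroup H2H10)

instance (p : Params) : Module ℂ p.Disp := inferInstanceAs (Module ℂ H2H10)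

variable {p : Params}

/-- The underlying element of `L²(0, 1)`. -/
def Disp.toL2 : p.Disp →ₗ[ℂ] L2 0 1 := H2H10.subtype

theorem Disp.memH (u : p.Disp) : MemH 2 0 1 u.toL2 := u.2.1

theorem Disp.value_zero (u : p.Disp) : value 0 1 u.toL2 0 = 0 := u.2.2.1

theorem Disp.value_one (u : p.Disp) : value 0 1 u.toL2 1 = 0 := u.2.2.2

theorem Disp.toL2_injective : Function.Injective (Disp.toL2 (p := p)) :=
  Subtype.val_injective

/-- The second weak derivative `u ↦ u_xx`. -/
def Disp.dxx : p.Disp →ₗ[ℂ] L2 0 1 where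
  toFun u := weakDeriv 0 1 2 u.toL2
  map_add' u w := by
    rw [map_add, weakDeriv_congr (Lp.coeFn_add u.toL2 w.toL2)]
    exact (u.memH.isWeakDeriv_add w.memH le_rfl).weakDeriv_eq
  map_smul' r u := by
    rw [map_smul, weakDeriv_congr (Lp.coeFn_smul r u.toL2)]
    exact (u.memH.isWeakDeriv_smul r le_rfl).weakDeriv_eq

theorem Disp.eq_zero_of_dxx (u : p.Disp) (h : u.dxx = 0) : u = 0 := by
  have h01 : (0 : ℝ) < 1 := zero_lt_one
  set f : ℝ → ℂ := (u.toL2 : ℝ → ℂ)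
  set g : L2 0 1 := weakDeriv 0 1 1 f
  have h1 : IsWeakDeriv 0 1 1 f g := u.memH.isWeakDeriv (by norm_num)
  have h2 : IsWeakDeriv 0 1 1 g (weakDeriv 0 1 2 f) :=
    h1.step (u.memH.isWeakDeriv (k := 2) le_rfl)
  have hz : weakDeriv 0 1 2 f = 0 := h
  obtain ⟨C, hC⟩ := ae_const_of_weakDeriv_zero h01 (L2.integrableOn g) (by
    intro φ hφ
    have := h2 φ hφ
    rw [iteratedDeriv_one, hz] at this
    rw [this, integral_congr_ae ((Lp.coeFn_zero ℂ 2 _).mono fun x hx => by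
      simp only [hx, Pi.zero_apply, smul_zero] :
      (fun x => φ x • (0 : L2 0 1) x) =ᵐ[volume.restrict (Ioo 0 1)] fun _ => (0 : ℂ))]
    simp)
  obtain ⟨C', hC'⟩ := (h1.congr_right hC).exists_primitive h01 (L2.integrableOn u.toL2) (by simp)
  have hcont : ContinuousOn (fun x : ℝ => C' + ∫ _t in (0 : ℝ)..x, C) (Icc 0 1) := by
    simp only [intervalIntegral.integral_const, sub_zero]
    fun_prop
  have hv : ∀ x ∈ Icc (0 : ℝ) 1, value 0 1 f x = C' + ∫ _t in (0 : ℝ)..x, C := fun x hx =>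
    HasValue.value_eq h01 hx ⟨_, hcont, hC', rfl⟩
  have e0 := (hv 0 (by simp)).symm.trans u.value_zero
  have e1 := (hv 1 (by simp)).symm.trans u.value_one
  simp only [intervalIntegral.integral_same, add_zero] at e0
  simp only [e0, zero_add, intervalIntegral.integral_const, sub_zero, one_smul] at e1
  apply Disp.toL2_injective
  rw [map_zero]
  refine Lp.ext (hC'.trans ?_)
  refine Filter.EventuallyEq.trans ?_ (Lp.coeFn_zero ℂ 2 _).symm
  exact ae_of_all _ fun x => by simp [e0, e1]

/-- The inner product `a ∫₀¹ u_xx w_xx dx`, conjugate-linear in the first variable (Mathlib's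
convention). -/
abbrev dispCore (p : Params) : InnerProductSpace.Core ℂ p.Disp where
  inner u w := (p.a : ℂ) * inner ℂ u.dxx w.dxx
  conj_inner_symm u w := by simp [inner_conj_symm]
  re_inner_nonneg u := by
    have : 0 ≤ (inner ℂ u.dxx u.dxx).re := inner_self_nonneg (𝕜 := ℂ)
    simpa using mul_nonneg p.a_pos.le this
  add_left u w z := by simp [inner_add_left, mul_add]
  smul_left u w r := by simp [inner_smul_left]; ring
  definite u h := by
    have ha : (p.a : ℂ) ≠ 0 := by exact_mod_cast p.a_pos.ne'
    exact u.eq_zero_of_dxx (inner_self_eq_zero.1 ((mul_eq_zero.1 h).resolve_left ha))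

instance (p : Params) : NormedAddCommGroup p.Disp := (dispCore p).toNormedAddCommGroup

instance (p : Params) : InnerProductSpace ℂ p.Disp := InnerProductSpace.ofCore (dispCore p).toCore

theorem Disp.inner_def (u w : p.Disp) : inner ℂ u w = (p.a : ℂ) * inner ℂ u.dxx w.dxx := rfl

/-- The energy space `(H²(0, 1) ∩ H¹₀(0, 1)) × L²(0, 1)` with the inner product
`∫₀¹ (a u₁_xx u₂_xx + v₁ v₂) dx` (one factor in each term being conjugated). -/
abbrev Energy (p : Params) : Type := WithLp 2 (p.Disp × L2 0 1)

/-- The first component `u` of `U = (u, v)`. -/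
def Energy.u (U : p.Energy) : L2 0 1 := U.fst.toL2

/-- The second component `v` of `U = (u, v)`. -/
def Energy.v (U : p.Energy) : L2 0 1 := U.snd

theorem Energy.memH_u (U : p.Energy) : MemH 2 0 1 U.u := Disp.memH U.fst

theorem Energy.u_add (U W : p.Energy) : (U + W).u = U.u + W.u := map_add _ _ _

theorem Energy.u_smul (r : ℂ) (U : p.Energy) : (r • U).u = r • U.u := map_smul _ _ _

theorem Energy.inner_eq (U W : p.Energy) : inner ℂ U W =
    ∫ x in Ioo (0 : ℝ) 1, ((p.a : ℂ) * (weakDeriv 0 1 2 W.u x *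
      (starRingEnd ℂ) (weakDeriv 0 1 2 U.u x)) + W.v x * (starRingEnd ℂ) (U.v x)) := by
  have h1 := L2.integrable_inner (𝕜 := ℂ) (weakDeriv 0 1 2 U.u) (weakDeriv 0 1 2 W.u)
  have h2 := L2.integrable_inner (𝕜 := ℂ) U.v W.v
  simp only [RCLike.inner_apply] at h1 h2
  rw [integral_add (h1.const_mul _) h2, integral_const_mul]
  rfl

/-- The domain of the beam operator: the pairs `(u, v)` in the energy space (so that already
`u ∈ H²(0, 1)` and `u(0) = u(1) = 0`) with `u ∈ H⁴(0, ξ) ∩ H⁴(ξ, 1)`, `v ∈ H²(0, 1)`,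
`v(0) = v(1) = 0`, `u_xx(0) = u_xx(1) = 0`, `u_xx(ξ⁻) = u_xx(ξ⁺)` and
`u_xxx(ξ⁺) - u_xxx(ξ⁻) = -(α / a) v(ξ)`. -/
structure InDomain (p : Params) (u v : ℝ → ℂ) : Prop where
  left : MemH 4 0 p.ξ u
  right : MemH 4 p.ξ 1 u
  vel : MemH 2 0 1 v
  vel_zero : value 0 1 v 0 = 0
  vel_one : value 0 1 v 1 = 0
  uxx_zero : value 0 p.ξ (weakDeriv 0 p.ξ 2 u) 0 = 0
  uxx_one : value p.ξ 1 (weakDeriv p.ξ 1 2 u) 1 = 0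
  uxx_jump : value 0 p.ξ (weakDeriv 0 p.ξ 2 u) p.ξ = value p.ξ 1 (weakDeriv p.ξ 1 2 u) p.ξ
  uxxx_jump : value p.ξ 1 (weakDeriv p.ξ 1 3 u) p.ξ - value 0 p.ξ (weakDeriv 0 p.ξ 3 u) p.ξ =
    -((p.α / p.a : ℝ) : ℂ) * value 0 1 v p.ξ

theorem ae_restrict_left (p : Params) {f g : ℝ → ℂ} (h : f =ᵐ[volume.restrict (Ioo 0 1)] g) :
    f =ᵐ[volume.restrict (Ioo 0 p.ξ)] g :=
  ae_restrict_of_ae_restrict_of_subset (Ioo_subset_Ioo le_rfl p.ξ_mem.2.le) h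

theorem ae_restrict_right (p : Params) {f g : ℝ → ℂ} (h : f =ᵐ[volume.restrict (Ioo 0 1)] g) :
    f =ᵐ[volume.restrict (Ioo p.ξ 1)] g :=
  ae_restrict_of_ae_restrict_of_subset (Ioo_subset_Ioo p.ξ_mem.1.le le_rfl) h

theorem InDomain.congr {u v u' v' : ℝ → ℂ} (h : p.InDomain u v)
    (hu : u =ᵐ[volume.restrict (Ioo 0 1)] u') (hv : v =ᵐ[volume.restrict (Ioo 0 1)] v') :
    p.InDomain u' v' := by
  have hl := p.ae_restrict_left hu
  have hr := p.ae_restrict_right hu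
  constructor
  · exact h.left.congr hl
  · exact h.right.congr hr
  · exact h.vel.congr hv
  · rw [← value_congr hv, h.vel_zero]
  · rw [← value_congr hv, h.vel_one]
  · rw [← weakDeriv_congr hl, h.uxx_zero]
  · rw [← weakDeriv_congr hr, h.uxx_one]
  · rw [← weakDeriv_congr hl, ← weakDeriv_congr hr, h.uxx_jump]
  · rw [← weakDeriv_congr hl, ← weakDeriv_congr hr, ← value_congr hv, h.uxxx_jump]

theorem InDomain.add {u v u' v' : ℝ → ℂ} (h : p.InDomain u v) (h' : p.InDomain u' v') :
    p.InDomain (fun x => u x + u' x) (fun x => v x + v' x) := by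
  have hξ := p.ξ_mem
  have m0 : (0 : ℝ) ∈ Icc 0 p.ξ := ⟨le_rfl, hξ.1.le⟩
  have m1 : p.ξ ∈ Icc 0 p.ξ := ⟨hξ.1.le, le_rfl⟩
  have m2 : p.ξ ∈ Icc p.ξ 1 := ⟨le_rfl, hξ.2.le⟩
  have m3 : (1 : ℝ) ∈ Icc p.ξ 1 := ⟨hξ.2.le, le_rfl⟩
  have m4 : p.ξ ∈ Icc (0 : ℝ) 1 := ⟨hξ.1.le, hξ.2.le⟩
  have e2 := h.uxx_jump
  have e2' := h'.uxx_jump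
  have e3 := h.uxxx_jump
  have e3' := h'.uxxx_jump
  constructor
  · exact h.left.add h'.left
  · exact h.right.add h'.right
  · exact h.vel.add h'.vel
  · rw [h.vel.value_add zero_lt_one h'.vel (by norm_num) (by simp), h.vel_zero, h'.vel_zero,
      add_zero]
  · rw [h.vel.value_add zero_lt_one h'.vel (by norm_num) (by simp), h.vel_one, h'.vel_one,
      add_zero]
  · rw [h.left.value_weakDeriv_add hξ.1 h'.left (by norm_num) m0, h.uxx_zero, h'.uxx_zero,
      add_zero]
  · rw [h.right.value_weakDeriv_add hξ.2 h'.right (by norm_num) m3, h.uxx_one, h'.uxx_one,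
      add_zero]
  · rw [h.left.value_weakDeriv_add hξ.1 h'.left (by norm_num) m1,
      h.right.value_weakDeriv_add hξ.2 h'.right (by norm_num) m2, e2, e2']
  · rw [h.left.value_weakDeriv_add hξ.1 h'.left (by norm_num) m1,
      h.right.value_weakDeriv_add hξ.2 h'.right (by norm_num) m2,
      h.vel.value_add zero_lt_one h'.vel (by norm_num) m4]
    linear_combination e3 + e3'

theorem InDomain.smul {u v : ℝ → ℂ} (h : p.InDomain u v) (r : ℂ) :
    p.InDomain (fun x => r • u x) (fun x => r • v x) := by
  have hξ := p.ξ_mem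
  have m0 : (0 : ℝ) ∈ Icc 0 p.ξ := ⟨le_rfl, hξ.1.le⟩
  have m1 : p.ξ ∈ Icc 0 p.ξ := ⟨hξ.1.le, le_rfl⟩
  have m2 : p.ξ ∈ Icc p.ξ 1 := ⟨le_rfl, hξ.2.le⟩
  have m3 : (1 : ℝ) ∈ Icc p.ξ 1 := ⟨hξ.2.le, le_rfl⟩
  have m4 : p.ξ ∈ Icc (0 : ℝ) 1 := ⟨hξ.1.le, hξ.2.le⟩
  have e2 := h.uxx_jump
  have e3 := h.uxxx_jump
  constructor
  · exact h.left.smul r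
  · exact h.right.smul r
  · exact h.vel.smul r
  · rw [h.vel.value_smul zero_lt_one r (by norm_num) (by simp), h.vel_zero, smul_zero]
  · rw [h.vel.value_smul zero_lt_one r (by norm_num) (by simp), h.vel_one, smul_zero]
  · rw [h.left.value_weakDeriv_smul hξ.1 r (by norm_num) m0, h.uxx_zero, smul_zero]
  · rw [h.right.value_weakDeriv_smul hξ.2 r (by norm_num) m3, h.uxx_one, smul_zero]
  · rw [h.left.value_weakDeriv_smul hξ.1 r (by norm_num) m1,
      h.right.value_weakDeriv_smul hξ.2 r (by norm_num) m2, e2]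
  · rw [h.left.value_weakDeriv_smul hξ.1 r (by norm_num) m1,
      h.right.value_weakDeriv_smul hξ.2 r (by norm_num) m2,
      h.vel.value_smul zero_lt_one r (by norm_num) m4]
    simp only [smul_eq_mul]
    linear_combination r * e3

theorem InDomain.zero : p.InDomain (fun _ => 0) (fun _ => 0) := by
  have hξ := p.ξ_mem
  have m0 : (0 : ℝ) ∈ Icc 0 p.ξ := ⟨le_rfl, hξ.1.le⟩
  have m1 : p.ξ ∈ Icc 0 p.ξ := ⟨hξ.1.le, le_rfl⟩
  have m2 : p.ξ ∈ Icc p.ξ 1 := ⟨le_rfl, hξ.2.le⟩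
  have m3 : (1 : ℝ) ∈ Icc p.ξ 1 := ⟨hξ.2.le, le_rfl⟩
  have m4 : p.ξ ∈ Icc (0 : ℝ) 1 := ⟨hξ.1.le, hξ.2.le⟩
  constructor
  · exact MemH.zero
  · exact MemH.zero
  · exact MemH.zero
  · exact Beam.value_zero zero_lt_one (by simp)
  · exact Beam.value_zero zero_lt_one (by simp)
  · exact value_weakDeriv_zero hξ.1 m0
  · exact value_weakDeriv_zero hξ.2 m3
  · rw [value_weakDeriv_zero hξ.1 m1, value_weakDeriv_zero hξ.2 m2]
  · rw [value_weakDeriv_zero hξ.1 m1, value_weakDeriv_zero hξ.2 m2,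
      Beam.value_zero zero_lt_one m4]
    simp

/-- The domain `D(𝒜)` as a subspace of the energy space. -/
def domain (p : Params) : Submodule ℂ p.Energy where
  carrier := {U | p.InDomain U.u U.v}
  add_mem' {U W} hU hW := (hU.add hW).congr
    (by rw [Energy.u_add]; exact (Lp.coeFn_add _ _).symm) (Lp.coeFn_add U.v W.v).symm
  zero_mem' := InDomain.zero.congr (Lp.coeFn_zero ℂ 2 _).symm (Lp.coeFn_zero ℂ 2 _).symm
  smul_mem' r U hU := (hU.smul r).congr
    (by rw [Energy.u_smul]; exact (Lp.coeFn_smul r U.u).symm) (Lp.coeFn_smul r U.v).symm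

/-- `g ∈ L²(0, 1)` is the distribution `-a u_xxxx - b v - α v(ξ) δ_ξ` on `(0, 1)`. -/
def IsAccel (p : Params) (u v : ℝ → ℂ) (g : L2 0 1) : Prop :=
  ∀ φ : ℝ → ℝ, IsTest 0 1 φ →
    ∫ x in Ioo 0 1, φ x • g x =
      -(p.a : ℂ) * (∫ x in Ioo 0 1, iteratedDeriv 4 φ x • u x)
        - (p.b : ℂ) * (∫ x in Ioo 0 1, φ x • v x)
        - (p.α : ℂ) * (φ p.ξ • value 0 1 v p.ξ)

theorem IsAccel.unique {u v : ℝ → ℂ} {g g' : L2 0 1} (h : p.IsAccel u v g)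
    (h' : p.IsAccel u v g') : g = g' :=
  Lp.ext (ae_eq_of_test (L2.integrableOn g) (L2.integrableOn g') fun φ hφ =>
    (h φ hφ).trans (h' φ hφ).symm)

theorem integral_split (p : Params) {f : ℝ → ℂ} (hf : IntegrableOn f (Ioo 0 1)) :
    ∫ x in Ioo 0 1, f x = (∫ x in Ioo 0 p.ξ, f x) + ∫ x in Ioo p.ξ 1, f x := by
  have hi := intervalIntegrable_of_Ioo zero_le_one hf
  have hξ := p.ξ_mem
  rw [setIntegral_Ioo zero_le_one, setIntegral_Ioo hξ.1.le, setIntegral_Ioo hξ.2.le,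
    intervalIntegral.integral_add_adjacent_intervals
      (hi.mono_set (uIcc_subset_uIcc_left ?_)) (hi.mono_set (uIcc_subset_uIcc_right ?_))]
  all_goals rw [uIcc_of_le zero_le_one]; exact ⟨hξ.1.le, hξ.2.le⟩

/-- For `(u, v)` in the domain, the fourth derivative of `u` on `(0, 1)` has at `ξ` exactly the
Dirac part that cancels `α v(ξ) δ_ξ`, so that the acceleration is in `L²(0, 1)`. -/
theorem exists_isAccel {u v : ℝ → ℂ} (hu : MemH 2 0 1 u) (h : p.InDomain u v) :
    ∃ g : L2 0 1, p.IsAccel u v g := by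
  have hξ := p.ξ_mem
  have ha : (p.a : ℂ) ≠ 0 := by exact_mod_cast p.a_pos.ne'
  set q₁ : L2 0 p.ξ := weakDeriv 0 p.ξ 4 u
  set q₂ : L2 p.ξ 1 := weakDeriv p.ξ 1 4 u
  have hL : MemLp ((Ioo 0 p.ξ).indicator q₁) 2 (volume.restrict (Ioo (0 : ℝ) 1)) := by
    rw [memLp_indicator_iff_restrict measurableSet_Ioo,
      Measure.restrict_restrict measurableSet_Ioo,
      inter_eq_left.2 (Ioo_subset_Ioo le_rfl hξ.2.le)]
    exact Lp.memLp q₁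
  have hR : MemLp ((Ioo p.ξ 1).indicator q₂) 2 (volume.restrict (Ioo (0 : ℝ) 1)) := by
    rw [memLp_indicator_iff_restrict measurableSet_Ioo,
      Measure.restrict_restrict measurableSet_Ioo,
      inter_eq_left.2 (Ioo_subset_Ioo hξ.1.le le_rfl)]
    exact Lp.memLp q₂
  have hG := ((hL.add hR).const_smul (-(p.a : ℂ))).sub (h.vel.1.const_smul (p.b : ℂ))
  refine ⟨hG.toLp _, fun φ hφ => ?_⟩
  have hLR := memLp_integrableOn (hL.add hR)
  have hv := memLp_integrableOn h.vel.1
  have i1 : Integrable (fun x => -(p.a : ℂ) * (φ x • ((Ioo 0 p.ξ).indicator q₁ +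
      (Ioo p.ξ 1).indicator q₂) x)) (volume.restrict (Ioo 0 1)) :=
    (hφ.integrable_smul hLR).const_mul _
  have i2 : Integrable (fun x => (p.b : ℂ) * (φ x • v x)) (volume.restrict (Ioo 0 1)) :=
    (hφ.integrable_smul hv).const_mul _
  have e1 : ∫ x in Ioo 0 1, φ x • (hG.toLp _) x =
      -(p.a : ℂ) * (∫ x in Ioo 0 1, φ x • ((Ioo 0 p.ξ).indicator q₁ +
        (Ioo p.ξ 1).indicator q₂) x) - (p.b : ℂ) * ∫ x in Ioo 0 1, φ x • v x := by
    rw [← integral_const_mul, ← integral_const_mul, ← integral_sub i1 i2]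
    refine integral_congr_ae (hG.coeFn_toLp.mono fun x hx => ?_)
    simp only [hx, Pi.sub_apply, Pi.smul_apply, smul_eq_mul, smul_sub, Complex.real_smul]
    ring
  have e2 : ∫ x in Ioo 0 1, φ x • ((Ioo 0 p.ξ).indicator q₁ + (Ioo p.ξ 1).indicator q₂) x =
      (∫ x in Ioo 0 p.ξ, φ x • q₁ x) + ∫ x in Ioo p.ξ 1, φ x • q₂ x := by
    rw [p.integral_split (hφ.integrable_smul hLR)]
    congr 1
    · refine setIntegral_congr_fun measurableSet_Ioo fun x hx => ?_
      have : x ∉ Ioo p.ξ 1 := fun h' => (h'.1.trans hx.2).false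
      simp [indicator_of_mem hx, indicator_of_notMem this]
    · refine setIntegral_congr_fun measurableSet_Ioo fun x hx => ?_
      have : x ∉ Ioo 0 p.ξ := fun h' => (h'.2.trans hx.1).false
      simp [indicator_of_mem hx, indicator_of_notMem this]
  have hu2 : IsWeakDeriv 0 1 2 u (weakDeriv 0 1 2 u) := hu.isWeakDeriv le_rfl
  have e3 : ∫ x in Ioo 0 1, iteratedDeriv 4 φ x • u x =
      ∫ x in Ioo 0 1, deriv (deriv φ) x • weakDeriv 0 1 2 u x := by
    have := hu2 _ hφ.test_deriv.test_deriv
    rw [← iteratedDeriv_succ', ← iteratedDeriv_succ'] at this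
    rw [this]; norm_num
  have hdd := hφ.test_deriv.test_deriv
  have l2 : (weakDeriv 0 1 2 u : ℝ → ℂ) =ᵐ[volume.restrict (Ioo 0 p.ξ)] weakDeriv 0 p.ξ 2 u :=
    (hu2.mono le_rfl hξ.2.le).unique (h.left.isWeakDeriv (by norm_num))
      ((L2.integrableOn _).mono_set (Ioo_subset_Ioo le_rfl hξ.2.le)) (L2.integrableOn _)
  have r2 : (weakDeriv 0 1 2 u : ℝ → ℂ) =ᵐ[volume.restrict (Ioo p.ξ 1)] weakDeriv p.ξ 1 2 u :=
    (hu2.mono hξ.1.le le_rfl).unique (h.right.isWeakDeriv (by norm_num))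
      ((L2.integrableOn _).mono_set (Ioo_subset_Ioo hξ.1.le le_rfl)) (L2.integrableOn _)
  have e4 : ∫ x in Ioo 0 1, deriv (deriv φ) x • weakDeriv 0 1 2 u x =
      (∫ x in Ioo 0 p.ξ, deriv (deriv φ) x • weakDeriv 0 p.ξ 2 u x) +
        ∫ x in Ioo p.ξ 1, deriv (deriv φ) x • weakDeriv p.ξ 1 2 u x := by
    rw [p.integral_split (hdd.integrable_smul (L2.integrableOn _))]
    congr 1
    · exact integral_congr_ae (l2.mono fun x hx => by simp only [hx])
    · exact integral_congr_ae (r2.mono fun x hx => by simp only [hx])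
  have j2 := h.uxx_jump
  have j3 := h.uxxx_jump
  rw [e1, e2, e3, e4, h.left.integral_deriv_deriv_smul hξ.1 hφ.1,
    h.right.integral_deriv_deriv_smul hξ.2 hφ.1, hφ.eq_zero (x := 0) (by simp),
    hφ.eq_zero (x := 1) (by simp), hφ.test_deriv.eq_zero (x := 0) (by simp),
    hφ.test_deriv.eq_zero (x := 1) (by simp), j2]
  have j3' : (p.a : ℂ) * (value p.ξ 1 (weakDeriv p.ξ 1 3 u) p.ξ
      - value 0 p.ξ (weakDeriv 0 p.ξ 3 u) p.ξ) = -(p.α : ℂ) * value 0 1 v p.ξ := by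
    rw [j3]; push_cast; field_simp
  simp only [Complex.real_smul, zero_smul, q₁, q₂]
  linear_combination (φ p.ξ : ℂ) * j3'

/-- The function `-a u_xxxx - b v - α v(ξ) δ_ξ ∈ L²(0, 1)` for `U = (u, v) ∈ D(𝒜)`. -/
def accel (U : p.domain) : L2 0 1 := (exists_isAccel (Energy.memH_u U.1) U.2).choose

theorem isAccel_accel (U : p.domain) : p.IsAccel U.1.u U.1.v (accel U) :=
  (exists_isAccel (Energy.memH_u U.1) U.2).choose_spec

/-- The velocity `v` of an element of the domain, as an element of `H²(0, 1) ∩ H¹₀(0, 1)`. -/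
def velocity (U : p.domain) : p.Disp := ⟨U.1.v, U.2.vel, U.2.vel_zero, U.2.vel_one⟩

theorem accel_add (U W : p.domain) : accel (U + W) = accel U + accel W := by
  refine (isAccel_accel (U + W)).unique fun φ hφ => ?_
  have hU := isAccel_accel U φ hφ
  have hW := isAccel_accel W φ hφ
  have h4 := hφ.test_iteratedDeriv 4
  have m4 : p.ξ ∈ Icc (0 : ℝ) 1 := ⟨p.ξ_mem.1.le, p.ξ_mem.2.le⟩
  have a1 : ∀ (χ : ℝ → ℝ), IsTest 0 1 χ → ∀ f g : L2 0 1,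
      ∫ x in Ioo 0 1, χ x • (f + g : L2 0 1) x =
        (∫ x in Ioo 0 1, χ x • f x) + ∫ x in Ioo 0 1, χ x • g x := fun χ hχ f g => by
    rw [← integral_add (hχ.integrable_smul (L2.integrableOn f))
      (hχ.integrable_smul (L2.integrableOn g))]
    exact integral_congr_ae ((Lp.coeFn_add f g).mono fun x hx => by
      simp only [hx, Pi.add_apply, smul_add])
  have ev : value 0 1 (U + W : p.domain).1.v p.ξ = value 0 1 U.1.v p.ξ + value 0 1 W.1.v p.ξ := by
    rw [← U.2.vel.value_add zero_lt_one W.2.vel (by norm_num) m4]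
    exact value_congr (Lp.coeFn_add U.1.v W.1.v)
  have eu : (U + W : p.domain).1.u = U.1.u + W.1.u := Energy.u_add _ _
  have ev' : (U + W : p.domain).1.v = U.1.v + W.1.v := rfl
  rw [ev, eu, ev', a1 _ hφ, a1 _ h4, a1 _ hφ, hU, hW, smul_add]
  ring

theorem accel_smul (r : ℂ) (U : p.domain) : accel (r • U) = r • accel U := by
  refine (isAccel_accel (r • U)).unique fun φ hφ => ?_
  have hU := isAccel_accel U φ hφ
  have m4 : p.ξ ∈ Icc (0 : ℝ) 1 := ⟨p.ξ_mem.1.le, p.ξ_mem.2.le⟩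
  have a1 : ∀ (χ : ℝ → ℝ) (f : L2 0 1), ∫ x in Ioo 0 1, χ x • (r • f : L2 0 1) x =
      r * ∫ x in Ioo 0 1, χ x • f x := fun χ f => by
    rw [← integral_const_mul]
    exact integral_congr_ae ((Lp.coeFn_smul r f).mono fun x hx => by
      simp only [hx, Pi.smul_apply, smul_eq_mul, Complex.real_smul]; ring)
  have ev : value 0 1 (r • U : p.domain).1.v p.ξ = r * value 0 1 U.1.v p.ξ := by
    rw [← smul_eq_mul, ← U.2.vel.value_smul zero_lt_one r (by norm_num) m4]
    exact value_congr (Lp.coeFn_smul r U.1.v)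
  have eu : (r • U : p.domain).1.u = r • U.1.u := Energy.u_smul _ _
  have ev' : (r • U : p.domain).1.v = r • U.1.v := rfl
  rw [ev, eu, ev', a1, a1, a1, hU]
  simp only [Complex.real_smul]
  ring

/-- The beam operator `𝒜 (u, v) = (v, -a u_xxxx - b v - α v(ξ) δ_ξ)` on the energy space. -/
def operator (p : Params) : p.Energy →ₗ.[ℂ] p.Energy where
  domain := p.domain
  toFun :=
    { toFun := fun U => WithLp.toLp 2 (velocity U, accel U)
      map_add' := fun U W => by rw [accel_add]; rfl
      map_smul' := fun r U => by rw [accel_smul]; rfl }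

end Params

end Beam

/-- An unbounded operator `A` on a complex inner product space is dissipative if
`Re ⟨A x, x⟩ ≤ 0` for every `x` in its domain. -/
def LinearPMap.IsDissipative {E : Type*} [NormedAddCommGroup E] [InnerProductSpace ℂ E]
    (A : E →ₗ.[ℂ] E) : Prop :=
  ∀ x : A.domain, (inner ℂ (x : E) (A x)).re ≤ 0

/-- `A` is m-dissipative if it is dissipative and `μ - A` is onto for every `μ > 0`. -/
def LinearPMap.IsMDissipative {E : Type*} [NormedAddCommGroup E] [InnerProductSpace ℂ E]
    (A : E →ₗ.[ℂ] E) : Prop :=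
  A.IsDissipative ∧
    ∀ μ : ℝ, 0 < μ → Function.Surjective fun x : A.domain => (μ : ℂ) • (x : E) - A x

end

noncomputable section

namespace Beam

/-! ### Sobolev functions on an interval -/

/-! Everything is expressed through the Dirichlet inverse `G` of the second derivative on `(0, 1)`.
Its kernel is `K(x, t) = x t - min x t`, which is real and symmetric, so `G` (`greenCLM`) is a
bounded self-adjoint operator on `L²`. For `k = K(ξ, ·)` (`greenVec`), `k_xx = δ_ξ` weakly and `⟨k,
w⟩ = (G w)(ξ)`; point evaluation and the Dirac term thus become `L²` objects.

For `(u, v)` in the domain with acceleration `g`, the function `a u_xx + α v(ξ) k` has second weak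
derivative `-(g + b v)` and vanishes at `0` and `1`. Hence `a u_xx + α v(ξ) k = G(-(g + b v))`
(`moment_eq`). Conversely, if `w` satisfies such an identity with some `q ∈ L²` in place of `-(g + b
v)`, then `u = G w` has the required piecewise regularity, boundary values and jumps
(`inDomain_of_moment`), because `k` is affine on either side of `ξ`.

Dissipation: since `v = G v_xx`, self-adjointness turns `a ⟨u_xx, v_xx⟩` into `-⟨g + b v, v⟩ - α
|v(ξ)|²`. Adding `⟨v, g⟩` and taking real parts cancels `g`.

Range: in `l U - 𝒜 U = (f, g)`, where `g` now denotes the second datum, put `u = G w` and `v = l u -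
f`. The moment identity becomes `a w + l (l + b) G² w + α l ⟨k, w⟩ k = G(g + (l + b) f) + α f(ξ) k`.
The operator on the left has quadratic form at least `a ‖w‖²`, so it is invertible
(`exists_green_equation`). This works for every `l ≥ 0`; the case `l = 0` is the surjectivity of
`-𝒜`. -/

theorem memLp_of_continuousOn {c d : ℝ} {f : ℝ → ℂ} (hf : ContinuousOn f (Icc c d)) :
    MemLp f 2 (volume.restrict (Ioo c d)) := by
  obtain ⟨C, hC⟩ := isCompact_Icc.exists_bound_of_continuousOn hf
  refine MemLp.of_bound
    ((hf.mono Ioo_subset_Icc_self).aestronglyMeasurable measurableSet_Ioo) C ?_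
  exact (ae_restrict_mem measurableSet_Ioo).mono fun x hx => hC x (Ioo_subset_Icc_self hx)

theorem value_of_continuousOn {c d x : ℝ} (hcd : c < d) (hx : x ∈ Icc c d) {f g : ℝ → ℂ}
    (hg : ContinuousOn g (Icc c d)) (hfg : f =ᵐ[volume.restrict (Ioo c d)] g) :
    value c d f x = g x :=
  HasValue.value_eq hcd hx ⟨g, hg, hfg, rfl⟩

theorem HasValue.mono {c d c' d' x : ℝ} {f : ℝ → ℂ} {z : ℂ} (h : HasValue c d f x z)
    (h1 : c ≤ c') (h2 : d' ≤ d) : HasValue c' d' f x z := by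
  obtain ⟨g, hg, hfg, hz⟩ := h
  exact ⟨g, hg.mono (Icc_subset_Icc h1 h2),
    ae_restrict_of_ae_restrict_of_subset (Ioo_subset_Ioo h1 h2) hfg, hz⟩

theorem isWeakDeriv_zero_order (c d : ℝ) (f : ℝ → ℂ) : IsWeakDeriv c d 0 f f := by
  intro φ _
  simp

theorem IsWeakDeriv.trans {c d : ℝ} {j k : ℕ} {f g h : ℝ → ℂ} (hfg : IsWeakDeriv c d j f g)
    (hgh : IsWeakDeriv c d k g h) : IsWeakDeriv c d (j + k) f h := by
  intro φ hφ
  have e : iteratedDeriv (j + k) φ = iteratedDeriv j (iteratedDeriv k φ) := by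
    simp only [iteratedDeriv_eq_iterate, Function.iterate_add_apply]
  rw [e, hfg _ (hφ.test_iteratedDeriv k), hgh φ hφ, pow_add, mul_assoc]

/-- Integration by parts, the boundary terms vanishing with the test function. This is the converse
of `IsWeakDeriv.exists_primitive` and the source of the explicit weak derivatives of Green's
potentials. -/
theorem isWeakDeriv_primitive {c d : ℝ} (hcd : c ≤ d) {g : ℝ → ℂ} (hg : IntegrableOn g (Ioo c d))
    (C : ℂ) : IsWeakDeriv c d 1 (fun x => C + ∫ t in c..x, g t) g := by
  intro φ hφ
  have hgi := intervalIntegrable_of_Ioo hcd hg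
  have hprim : ContinuousOn (fun x => ∫ t in c..x, g t) (uIcc c d) :=
    intervalIntegral.continuousOn_primitive_interval' hgi (by simp)
  have hd : Continuous (deriv φ) := hφ.1.continuous_deriv (by simp)
  have i1 : IntervalIntegrable (fun x => deriv φ x • C) volume c d :=
    (hd.smul continuous_const).intervalIntegrable _ _
  have i2 : IntervalIntegrable (fun x => deriv φ x • ∫ t in c..x, g t) volume c d :=
    (hd.continuousOn.smul hprim).intervalIntegrable
  rw [iteratedDeriv_one, setIntegral_Ioo hcd, setIntegral_Ioo hcd]
  simp only [smul_add]
  rw [intervalIntegral.integral_add i1 i2, ibp hφ.1 hgi, intervalIntegral.integral_smul_const,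
    intervalIntegral.integral_deriv_eq_sub (fun x _ => (hφ.1.differentiable (by simp)) x)
      (hd.intervalIntegrable _ _), hφ.eq_zero (x := c) (by simp), hφ.eq_zero (x := d) (by simp)]
  simp

theorem MemH.mono {m : ℕ} {c d c' d' : ℝ} {f : ℝ → ℂ} (h : MemH m c d f)
    (h1 : c ≤ c') (h2 : d' ≤ d) : MemH m c' d' f := by
  have hs : volume.restrict (Ioo c' d') ≤ volume.restrict (Ioo c d) :=
    Measure.restrict_mono (Ioo_subset_Ioo h1 h2) le_rfl
  refine ⟨h.1.mono_measure hs, fun k hk => ?_⟩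
  obtain ⟨g, hg⟩ := h.2 k hk
  have hgm : MemLp g 2 (volume.restrict (Ioo c' d')) := (Lp.memLp g).mono_measure hs
  exact ⟨hgm.toLp g, (hg.mono h1 h2).congr_right hgm.coeFn_toLp.symm⟩

theorem memH_zero {c d : ℝ} {f : ℝ → ℂ} (hf : MemLp f 2 (volume.restrict (Ioo c d))) :
    MemH 0 c d f :=
  ⟨hf, fun k hk => ⟨hf.toLp f, by
    obtain rfl : k = 0 := by omega
    exact (isWeakDeriv_zero_order c d f).congr_right hf.coeFn_toLp.symm⟩⟩

/-- Orders above `m` come from composing weak derivatives. With `m = n = 2`, this turns `H²`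
regularity of `u_xx` into `H⁴` regularity of `u`. -/
theorem MemH.extend {m n : ℕ} {c d : ℝ} {f w : ℝ → ℂ} (hf : MemH m c d f)
    (hw : MemH n c d w) (h : IsWeakDeriv c d m f w) : MemH (m + n) c d f := by
  refine ⟨hf.1, fun k hk => ?_⟩
  rcases le_total k m with hkm | hkm
  · exact hf.2 k hkm
  · obtain ⟨j, rfl⟩ := Nat.exists_eq_add_of_le hkm
    exact ⟨weakDeriv c d j w, h.trans (hw.isWeakDeriv (by omega))⟩

theorem IsWeakDeriv.memH_succ {m : ℕ} {c d : ℝ} {f g : ℝ → ℂ} (h : IsWeakDeriv c d 1 f g)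
    (hf : MemLp f 2 (volume.restrict (Ioo c d))) (hg : MemH m c d g) : MemH (m + 1) c d f := by
  refine ⟨hf, fun k hk => ?_⟩
  rcases k with _ | k
  · exact (memH_zero hf).2 0 le_rfl
  · obtain ⟨w, hw⟩ := hg.2 k (by omega)
    exact ⟨w, add_comm 1 k ▸ h.trans hw⟩

theorem IsWeakDeriv.weakDeriv_ae_eq {k : ℕ} {c d : ℝ} {f g : ℝ → ℂ} (h : IsWeakDeriv c d k f g)
    (hg : MemLp g 2 (volume.restrict (Ioo c d))) :
    (weakDeriv c d k f : ℝ → ℂ) =ᵐ[volume.restrict (Ioo c d)] g := by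
  rw [(h.congr_right hg.coeFn_toLp.symm : IsWeakDeriv c d k f (hg.toLp g)).weakDeriv_eq]
  exact hg.coeFn_toLp

/-- Du Bois-Reymond of order two: a function with zero second weak derivative is affine. -/
theorem ae_affine_of_weakDeriv_zero {c d : ℝ} (hcd : c < d) {h : ℝ → ℂ}
    (hh : IntegrableOn h (Ioo c d)) (h0 : IsWeakDeriv c d 2 h fun _ => 0) :
    ∃ A B : ℂ, h =ᵐ[volume.restrict (Ioo c d)] fun x => A + x * B := by
  obtain ⟨ψ, hψ, hψ1⟩ := exists_test_integral_one hcd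
  -- The slope is forced: for `h = A + x B`, integration by parts gives `∫ ψ' h = -B ∫ ψ = -B`.
  set B : ℂ := -∫ x in Ioo c d, deriv ψ x • h x with hB
  have hlin : IntegrableOn (fun x : ℝ => (x : ℂ) * B) (Ioo c d) :=
    (Continuous.integrableOn_Icc (by fun_prop)).mono_set Ioo_subset_Icc_self
  have hw : ∀ φ, IsTest c d φ →
      ∫ x in Ioo c d, deriv φ x • ((x : ℂ) * B) = -∫ x in Ioo c d, φ x • B := by
    intro φ hφ
    have := isWeakDeriv_primitive hcd.le (g := fun _ => B) (by simp) (c * B) φ hφ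
    simp only [intervalIntegral.integral_const, iteratedDeriv_one, pow_one, neg_one_mul] at this
    rw [← this]
    refine integral_congr_ae (ae_of_all _ fun x => ?_)
    simp only [Complex.real_smul, Complex.ofReal_sub]
    ring
  obtain ⟨A, hA⟩ := ae_const_of_weakDeriv_zero hcd (hh.sub hlin) (by
    intro φ hφ
    set m := ∫ x in c..d, φ x with hm
    -- No first weak derivative of `h` is available, so the first-order result cannot simply be
    -- applied twice. Instead `φ - m ψ` has mean zero and is `Φ'` for a test function `Φ`; testing
    -- the hypothesis with `Φ` gives `∫ φ' h = m ∫ ψ' h = -m B`, so `h - x B` has zero weak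
    -- derivative.
    have hT : IsTest c d (fun x => φ x - m * ψ x) := by
      have e : (fun x => φ x - m * ψ x) = φ - fun x => m * ψ x := rfl
      refine ⟨hφ.1.sub (contDiff_const.mul hψ.1), ?_, ?_⟩
      · rw [e, sub_eq_add_neg]
        exact hφ.2.1.add (hψ.2.1.mul_left.neg)
      · rw [e]
        refine (tsupport_sub _ _).trans (union_subset hφ.2.2 (Subset.trans ?_ hψ.2.2))
        exact tsupport_mul_subset_right
    obtain ⟨Φ, hΦ, hΦ'⟩ := hT.primitive (by
      rw [intervalIntegral.integral_sub (hφ.1.continuous.intervalIntegrable _ _)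
        ((hψ.1.continuous.const_mul m).intervalIntegrable _ _),
        intervalIntegral.integral_const_mul, hψ1]
      simp [hm])
    have hm' : ∫ x in Ioo c d, φ x = m := by
      rw [hm, intervalIntegral.integral_of_le hcd.le, integral_Ioc_eq_integral_Ioo]
    have key := h0 Φ hΦ
    have e2 : iteratedDeriv 2 Φ = fun x => deriv φ x - m * deriv ψ x := by
      rw [iteratedDeriv_succ', hΦ', iteratedDeriv_one]
      funext x
      rw [deriv_fun_sub ((hφ.1.differentiable (by simp)) x)
        (((hψ.1.differentiable (by simp)) x).const_mul m), deriv_const_mul_field]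
    have e : ∀ x, (deriv φ x - m * deriv ψ x) • h x =
        deriv φ x • h x - m • (deriv ψ x • h x) := fun x => by rw [sub_smul, mul_smul]
    simp only [e2, e, smul_zero, integral_zero, mul_zero] at key
    have i1 := hφ.test_deriv.integrable_smul hh
    have i2 : Integrable (fun x => m • (deriv ψ x • h x)) (volume.restrict (Ioo c d)) :=
      (hψ.test_deriv.integrable_smul hh).smul m
    rw [integral_sub i1 i2, integral_smul, sub_eq_zero] at key
    simp only [Pi.sub_apply, smul_sub]
    rw [integral_sub i1 (hφ.test_deriv.integrable_smul hlin), key, hw φ hφ, integral_smul_const,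
      hm', hB, smul_neg]
    ring)
  refine ⟨A, B, hA.mono fun x hx => ?_⟩
  simp only [Pi.sub_apply] at hx
  rw [← hx]; ring

/-- A function with zero second weak derivative and zero boundary values vanishes. -/
theorem ae_zero_of_weakDeriv_zero {c d ξ : ℝ} (h1 : c < ξ) (h2 : ξ < d) {h : ℝ → ℂ}
    (hh : IntegrableOn h (Ioo c d)) (h0 : IsWeakDeriv c d 2 h fun _ => 0)
    (hc : HasValue c ξ h c 0) (hd : HasValue ξ d h d 0) :
    h =ᵐ[volume.restrict (Ioo c d)] fun _ => 0 := by
  obtain ⟨A, B, hAB⟩ := ae_affine_of_weakDeriv_zero (h1.trans h2) hh h0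
  have hcont : ∀ s : Set ℝ, ContinuousOn (fun x : ℝ => A + x * B) s := fun s => by fun_prop
  have e0 := hc.unique h1 ⟨le_rfl, h1.le⟩ ⟨_, hcont _,
    ae_restrict_of_ae_restrict_of_subset (Ioo_subset_Ioo le_rfl h2.le) hAB, rfl⟩
  have e1 := hd.unique h2 ⟨h2.le, le_rfl⟩ ⟨_, hcont _,
    ae_restrict_of_ae_restrict_of_subset (Ioo_subset_Ioo h1.le le_rfl) hAB, rfl⟩
  have hne : (d : ℂ) - c ≠ 0 := by
    rw [← Complex.ofReal_sub]
    exact_mod_cast (sub_pos.2 (h1.trans h2)).ne'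
  have hB : B = 0 := by
    refine (mul_eq_zero.1 (?_ : ((d : ℂ) - c) * B = 0)).resolve_left hne
    linear_combination e0 - e1
  have hA : A = 0 := by rw [hB] at e0; simpa using e0.symm
  simpa [hA, hB] using hAB

/-! ### Green's function of the second derivative with Dirichlet boundary conditions -/

/-- The derivative of `green g`. -/
def greenSlope (g : ℝ → ℂ) (x : ℝ) : ℂ :=
  -(∫ s in (0 : ℝ)..1, ∫ t in (0 : ℝ)..s, g t) + ∫ t in (0 : ℝ)..x, g t

/-- The solution `u` of `u_xx = g` on `(0, 1)` with `u(0) = u(1) = 0`. -/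
def green (g : ℝ → ℂ) (x : ℝ) : ℂ := ∫ s in (0 : ℝ)..x, greenSlope g s

variable {g : ℝ → ℂ}

theorem continuousOn_primitive_unit (hg : IntegrableOn g (Ioo 0 1)) :
    ContinuousOn (fun x => ∫ t in (0 : ℝ)..x, g t) (Icc 0 1) := by
  rw [← uIcc_of_le zero_le_one]
  exact intervalIntegral.continuousOn_primitive_interval'
    (intervalIntegrable_of_Ioo zero_le_one hg) (by simp)

theorem continuousOn_greenSlope (hg : IntegrableOn g (Ioo 0 1)) :
    ContinuousOn (greenSlope g) (Icc 0 1) :=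
  continuousOn_const.add (continuousOn_primitive_unit hg)

theorem integrableOn_greenSlope (hg : IntegrableOn g (Ioo 0 1)) :
    IntegrableOn (greenSlope g) (Ioo 0 1) :=
  memLp_integrableOn (memLp_of_continuousOn (continuousOn_greenSlope hg))

theorem continuousOn_green (hg : IntegrableOn g (Ioo 0 1)) : ContinuousOn (green g) (Icc 0 1) :=
  continuousOn_primitive_unit (integrableOn_greenSlope hg)

/-- The constant in `greenSlope` integrates to a linear correction of the double primitive, chosen
to cancel its value at `1`. -/
theorem green_eq_sub (hg : IntegrableOn g (Ioo 0 1)) {x : ℝ} (hx : x ∈ Icc (0 : ℝ) 1) :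
    green g x = (∫ s in (0 : ℝ)..x, ∫ t in (0 : ℝ)..s, g t) -
      x * ∫ s in (0 : ℝ)..1, ∫ t in (0 : ℝ)..s, g t := by
  have hi : IntervalIntegrable (fun x => ∫ t in (0 : ℝ)..x, g t) volume 0 x :=
    ((continuousOn_primitive_unit hg).mono
      (by rw [uIcc_of_le hx.1]; exact Icc_subset_Icc le_rfl hx.2)).intervalIntegrable
  simp only [green, greenSlope]
  rw [intervalIntegral.integral_add (by simp) hi, intervalIntegral.integral_const]
  simp only [sub_zero, Complex.real_smul]
  ring

theorem green_zero : green g 0 = 0 := by simp [green]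

theorem green_one (hg : IntegrableOn g (Ioo 0 1)) : green g 1 = 0 := by
  rw [green_eq_sub hg (by simp)]
  simp

theorem isWeakDeriv_green (hg : IntegrableOn g (Ioo 0 1)) :
    IsWeakDeriv 0 1 1 (green g) (greenSlope g) := by
  have e : green g = fun x => 0 + ∫ s in (0 : ℝ)..x, greenSlope g s :=
    funext fun x => (zero_add _).symm
  rw [e]
  exact isWeakDeriv_primitive zero_le_one (integrableOn_greenSlope hg) 0

theorem isWeakDeriv_greenSlope (hg : IntegrableOn g (Ioo 0 1)) :
    IsWeakDeriv 0 1 1 (greenSlope g) g :=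
  isWeakDeriv_primitive zero_le_one hg _

theorem memLp_green (hg : IntegrableOn g (Ioo 0 1)) :
    MemLp (green g) 2 (volume.restrict (Ioo 0 1)) :=
  memLp_of_continuousOn (continuousOn_green hg)

theorem memH_green (hg : MemLp g 2 (volume.restrict (Ioo (0 : ℝ) 1))) : MemH 2 0 1 (green g) := by
  have hi := memLp_integrableOn hg
  exact (isWeakDeriv_green hi).memH_succ (memLp_green hi)
    ((isWeakDeriv_greenSlope hi).memH_succ (memLp_of_continuousOn (continuousOn_greenSlope hi))
      (memH_zero hg))

/-- Cauchy's formula for repeated integration: integrate by parts with the weight `s - x`, whose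
zero at `s = x` removes the boundary term. -/
theorem integral_primitive {x : ℝ} (hg : IntervalIntegrable g volume 0 x) :
    ∫ s in (0 : ℝ)..x, ∫ t in (0 : ℝ)..s, g t = ∫ t in (0 : ℝ)..x, (x - t) • g t := by
  have h := ibp (φ := fun s => s - x) (by fun_prop) hg
  simp only [deriv_sub_const, deriv_id'', one_smul, sub_self, zero_smul, zero_sub] at h
  rw [h, ← intervalIntegral.integral_neg]
  refine intervalIntegral.integral_congr fun t _ => ?_
  simp only [← neg_smul, neg_sub]

/-- Green's function of the second derivative on `(0, 1)`. -/
def greenKernel (x t : ℝ) : ℝ := x * t - min x t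

theorem greenKernel_comm (x t : ℝ) : greenKernel x t = greenKernel t x := by
  rw [greenKernel, greenKernel, mul_comm, min_comm]

theorem continuous_greenKernel : Continuous fun z : ℝ × ℝ => greenKernel z.1 z.2 := by
  unfold greenKernel; fun_prop

/-- By Cauchy's formula the solution is `∫₀ˣ (x - t) g - x ∫₀¹ (1 - t) g`. Splitting the second
integral at `x` leaves the weight `x t - t` on `(0, x)` and `x t - x` on `(x, 1)`. -/
theorem green_eq_integral (hg : IntegrableOn g (Ioo 0 1)) {x : ℝ} (hx : x ∈ Icc (0 : ℝ) 1) :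
    green g x = ∫ t in Ioo 0 1, greenKernel x t • g t := by
  have hi := intervalIntegrable_of_Ioo zero_le_one hg
  have m : x ∈ uIcc (0 : ℝ) 1 := by rwa [uIcc_of_le zero_le_one]
  have hi1 : IntervalIntegrable g volume 0 x := hi.mono_set (uIcc_subset_uIcc_left m)
  have hi2 : IntervalIntegrable g volume x 1 := hi.mono_set (uIcc_subset_uIcc_right m)
  have hs : ∀ (k : ℝ → ℝ) (_ : Continuous k) {a b : ℝ}, IntervalIntegrable g volume a b →
      IntervalIntegrable (fun t => k t • g t) volume a b := fun k hk _ _ h =>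
    h.continuousOn_smul hk.continuousOn
  have hK : Continuous (greenKernel x) := by unfold greenKernel; fun_prop
  rw [green_eq_sub hg hx, integral_primitive hi1, integral_primitive hi, setIntegral_Ioo zero_le_one,
    ← intervalIntegral.integral_add_adjacent_intervals (hs _ hK hi1) (hs _ hK hi2),
    ← intervalIntegral.integral_add_adjacent_intervals (hs (fun t => 1 - t) (by fun_prop) hi1)
      (hs (fun t => 1 - t) (by fun_prop) hi2)]
  have e1 : ∫ t in (0 : ℝ)..x, greenKernel x t • g t =
      (∫ t in (0 : ℝ)..x, (x - t) • g t) - x * ∫ t in (0 : ℝ)..x, (1 - t) • g t := by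
    rw [← intervalIntegral.integral_const_mul, ← intervalIntegral.integral_sub
      (hs (fun t => x - t) (by fun_prop) hi1)
      ((hs (fun t => 1 - t) (by fun_prop) hi1).const_mul _)]
    refine intervalIntegral.integral_congr fun t ht => ?_
    rw [uIcc_of_le hx.1] at ht
    simp only [greenKernel, min_eq_right ht.2, Complex.real_smul]
    push_cast
    ring
  have e2 : ∫ t in x..1, greenKernel x t • g t = - (x * ∫ t in x..1, (1 - t) • g t) := by
    rw [← intervalIntegral.integral_const_mul, ← intervalIntegral.integral_neg]
    refine intervalIntegral.integral_congr fun t ht => ?_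
    rw [uIcc_of_le hx.2] at ht
    simp only [greenKernel, min_eq_left ht.1, Complex.real_smul]
    push_cast
    ring
  rw [e1, e2]
  ring

/-- A test function is recovered from `φ''` by the Green potential, because `φ` and `φ'` vanish at
both ends. Read in `t`, this says that the kernel with pole `x` has second weak derivative `δ_x`. -/
theorem IsTest.integral_greenKernel {φ : ℝ → ℝ} (hφ : IsTest 0 1 φ) {x : ℝ}
    (hx : x ∈ Icc (0 : ℝ) 1) :
    ∫ t in Ioo 0 1, iteratedDeriv 2 φ t • (greenKernel x t : ℂ) = φ x := by
  have hd := hφ.test_deriv.test_deriv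
  have hint : ∀ ψ : ℝ → ℝ, IsTest 0 1 ψ → ∀ y, ∫ t in (0 : ℝ)..y, ((deriv ψ t : ℝ) : ℂ) = ψ y := by
    intro ψ hψ y
    rw [intervalIntegral.integral_ofReal, intervalIntegral.integral_deriv_eq_sub
      (fun x _ => (hψ.1.differentiable (by simp)) x)
      (hψ.test_deriv.1.continuous.intervalIntegrable _ _), hψ.eq_zero (x := 0) (by simp), sub_zero]
  have hi : IntegrableOn (fun t => ((deriv (deriv φ) t : ℝ) : ℂ)) (Ioo 0 1) :=
    (Continuous.integrableOn_Icc
      (Complex.continuous_ofReal.comp hd.1.continuous)).mono_set Ioo_subset_Icc_self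
  have h := green_eq_sub hi hx
  simp only [hint _ hφ.test_deriv, hint _ hφ] at h
  rw [hφ.eq_zero (x := 1) (by simp), Complex.ofReal_zero, mul_zero, sub_zero,
    green_eq_integral hi hx] at h
  rw [← h]
  refine integral_congr_ae (ae_of_all _ fun t => ?_)
  simp only [iteratedDeriv_succ', iteratedDeriv_zero, Complex.real_smul]
  ring

/-! ### Green's operator on `L²(0, 1)` -/

theorem L2.inner_eq {c d : ℝ} (f g : L2 c d) :
    inner ℂ f g = ∫ x in Ioo c d, g x * (starRingEnd ℂ) (f x) := by
  simp only [L2.inner_def, RCLike.inner_apply]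

theorem L2.inner_congr {c d : ℝ} {f g : L2 c d} {f' g' : ℝ → ℂ}
    (hf : f =ᵐ[volume.restrict (Ioo c d)] f') (hg : g =ᵐ[volume.restrict (Ioo c d)] g') :
    inner ℂ f g = ∫ x in Ioo c d, g' x * (starRingEnd ℂ) (f' x) := by
  rw [L2.inner_eq]
  refine integral_congr_ae ?_
  filter_upwards [hf, hg] with x h1 h2
  rw [h1, h2]

theorem integrable_greenKernel_smul {g : ℝ → ℂ} (hg : IntegrableOn g (Ioo 0 1)) (x : ℝ) :
    Integrable (fun t => greenKernel x t • g t) (volume.restrict (Ioo 0 1)) := by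
  refine (intervalIntegrable_iff_integrableOn_Ioo_of_le zero_le_one).1
    ((intervalIntegrable_of_Ioo zero_le_one hg).continuousOn_smul (Continuous.continuousOn ?_))
  unfold greenKernel
  fun_prop

/-- `greenMap g` is the solution `u` of `u_xx = g` with `u(0) = u(1) = 0`. -/
def greenMap : L2 0 1 →ₗ[ℂ] L2 0 1 where
  toFun w := (memLp_green (L2.integrableOn w)).toLp (green w)
  map_add' w z := by
    refine Lp.ext ?_
    filter_upwards [(memLp_green (L2.integrableOn (w + z))).coeFn_toLp,
      (memLp_green (L2.integrableOn w)).coeFn_toLp, (memLp_green (L2.integrableOn z)).coeFn_toLp,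
      Lp.coeFn_add ((memLp_green (L2.integrableOn w)).toLp (green w))
        ((memLp_green (L2.integrableOn z)).toLp (green z)),
      ae_restrict_mem measurableSet_Ioo] with x h1 h2 h3 h4 hx
    have hx' := Ioo_subset_Icc_self hx
    -- The representative of the sum agrees with the sum of representatives only almost everywhere,
    -- so additivity is checked under the kernel integral.
    rw [h1, h4, Pi.add_apply, h2, h3, green_eq_integral (L2.integrableOn _) hx',
      green_eq_integral (L2.integrableOn _) hx', green_eq_integral (L2.integrableOn _) hx',
      ← integral_add (integrable_greenKernel_smul (L2.integrableOn w) x)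
        (integrable_greenKernel_smul (L2.integrableOn z) x)]
    refine integral_congr_ae ((Lp.coeFn_add w z).mono fun t ht => ?_)
    simp only [ht, Pi.add_apply, smul_add]
  map_smul' r w := by
    refine Lp.ext ?_
    filter_upwards [(memLp_green (L2.integrableOn (r • w))).coeFn_toLp,
      (memLp_green (L2.integrableOn w)).coeFn_toLp,
      Lp.coeFn_smul r ((memLp_green (L2.integrableOn w)).toLp (green w)),
      ae_restrict_mem measurableSet_Ioo] with x h1 h2 h3 hx
    have hx' := Ioo_subset_Icc_self hx
    rw [h1, RingHom.id_apply, h3, Pi.smul_apply, h2, green_eq_integral (L2.integrableOn _) hx',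
      green_eq_integral (L2.integrableOn _) hx', ← integral_smul]
    refine integral_congr_ae ((Lp.coeFn_smul r w).mono fun t ht => ?_)
    simp only [ht, Pi.smul_apply]
    rw [smul_comm]

theorem greenMap_ae_eq (w : L2 0 1) : greenMap w =ᵐ[volume.restrict (Ioo 0 1)] green w :=
  (memLp_green (L2.integrableOn w)).coeFn_toLp

/-- Fubini together with the kernel being real and symmetric. Boundedness follows without an
estimate: a symmetric operator defined on a whole Hilbert space is continuous (Hellinger–Toeplitz).
-/
theorem greenMap_isSymmetric : greenMap.IsSymmetric := by
  intro w z
  rw [L2.inner_congr (greenMap_ae_eq w) (ae_eq_refl _),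
    L2.inner_congr (ae_eq_refl _) (greenMap_ae_eq z)]
  have hF : Integrable (Function.uncurry fun x t : ℝ =>
      greenKernel x t • (z x * (starRingEnd ℂ) (w t)))
      ((volume.restrict (Ioo (0 : ℝ) 1)).prod (volume.restrict (Ioo (0 : ℝ) 1))) := by
    have hw : Integrable (fun t => (starRingEnd ℂ) (w t)) (volume.restrict (Ioo (0 : ℝ) 1)) :=
      Complex.conjLIE.toContinuousLinearEquiv.toContinuousLinearMap.integrable_comp
        (L2.integrableOn w)
    -- Both `x t` and `min x t` lie in `(0, 1)`, so the kernel is bounded by `1`; the constant `2`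
    -- is slack.
    refine Integrable.bdd_smul (C := 2) ((L2.integrableOn z : Integrable z _).mul_prod hw)
      continuous_greenKernel.aestronglyMeasurable ?_
    rw [Measure.prod_restrict]
    filter_upwards [ae_restrict_mem (measurableSet_Ioo.prod measurableSet_Ioo)] with y hy
    obtain ⟨⟨a1, a2⟩, b1, b2⟩ := hy
    rw [Real.norm_eq_abs, abs_le, greenKernel]
    have := mul_pos a1 b1
    have := mul_lt_one_of_nonneg_of_lt_one_left a1.le a2 b2.le
    have := min_le_left y.1 y.2
    have := lt_min a1 b1
    constructor <;> linarith
  calc ∫ x in Ioo 0 1, z x * (starRingEnd ℂ) (green w x)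
      = ∫ x in Ioo 0 1, ∫ t in Ioo 0 1, greenKernel x t • (z x * (starRingEnd ℂ) (w t)) := by
        refine setIntegral_congr_fun measurableSet_Ioo fun x hx => ?_
        rw [green_eq_integral (L2.integrableOn w) (Ioo_subset_Icc_self hx), ← integral_conj,
          ← integral_const_mul]
        refine integral_congr_ae (ae_of_all _ fun t => ?_)
        simp only [Complex.real_smul, map_mul, Complex.conj_ofReal]
        ring
    _ = ∫ t in Ioo 0 1, ∫ x in Ioo 0 1, greenKernel x t • (z x * (starRingEnd ℂ) (w t)) :=
        integral_integral_swap hF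
    _ = ∫ t in Ioo 0 1, green z t * (starRingEnd ℂ) (w t) := by
        refine setIntegral_congr_fun measurableSet_Ioo fun t ht => ?_
        rw [green_eq_integral (L2.integrableOn z) (Ioo_subset_Icc_self ht), ← integral_mul_const]
        refine integral_congr_ae (ae_of_all _ fun x => ?_)
        simp only [Complex.real_smul, greenKernel_comm x t]
        ring

/-- Green's operator as a bounded operator on `L²(0, 1)`. -/
def greenCLM : L2 0 1 →L[ℂ] L2 0 1 := ⟨greenMap, greenMap_isSymmetric.continuous⟩

theorem greenCLM_ae_eq (w : L2 0 1) : greenCLM w =ᵐ[volume.restrict (Ioo 0 1)] green w :=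
  greenMap_ae_eq w

theorem inner_greenCLM (w z : L2 0 1) : inner ℂ (greenCLM w) z = inner ℂ w (greenCLM z) :=
  greenMap_isSymmetric w z

theorem continuous_greenKernel_right (x : ℝ) : Continuous fun t => (greenKernel x t : ℂ) := by
  unfold greenKernel
  fun_prop

/-- Green's function with pole `x`, as an element of `L²(0, 1)`. -/
def greenVec (x : ℝ) : L2 0 1 :=
  (memLp_of_continuousOn (continuous_greenKernel_right x).continuousOn).toLp _

theorem greenVec_ae_eq (x : ℝ) :
    greenVec x =ᵐ[volume.restrict (Ioo 0 1)] fun t => (greenKernel x t : ℂ) :=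
  MemLp.coeFn_toLp _

/-- The kernel is real, so conjugation in the first slot is harmless. Evaluation of `G w` at a point
is thereby a bounded functional of `w`. -/
theorem inner_greenVec {x : ℝ} (hx : x ∈ Icc (0 : ℝ) 1) (w : L2 0 1) :
    inner ℂ (greenVec x) w = green w x := by
  rw [L2.inner_congr (greenVec_ae_eq x) (ae_eq_refl _), green_eq_integral (L2.integrableOn w) hx]
  refine integral_congr_ae (ae_of_all _ fun t => ?_)
  simp only [Complex.real_smul, Complex.conj_ofReal]
  ring

theorem memH_greenCLM (w : L2 0 1) : MemH 2 0 1 (greenCLM w) :=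
  (memH_green (Lp.memLp w)).congr (greenCLM_ae_eq w).symm

theorem isWeakDeriv_two_greenCLM (w : L2 0 1) : IsWeakDeriv 0 1 2 (greenCLM w) w :=
  ((isWeakDeriv_green (L2.integrableOn w)).trans
    (isWeakDeriv_greenSlope (L2.integrableOn w))).congr_left (greenCLM_ae_eq w).symm

theorem hasValue_greenCLM (w : L2 0 1) (x : ℝ) : HasValue 0 1 (greenCLM w) x (green w x) :=
  ⟨_, continuousOn_green (L2.integrableOn w), greenCLM_ae_eq w, rfl⟩

theorem value_greenCLM (w : L2 0 1) {x : ℝ} (hx : x ∈ Icc (0 : ℝ) 1) :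
    value 0 1 (greenCLM w) x = green w x :=
  (hasValue_greenCLM w x).value_eq zero_lt_one hx

theorem hasValue_greenVec (ξ x : ℝ) : HasValue 0 1 (greenVec ξ) x (greenKernel ξ x) :=
  ⟨_, (continuous_greenKernel_right ξ).continuousOn, greenVec_ae_eq ξ, rfl⟩

theorem IsTest.integral_greenVec {φ : ℝ → ℝ} (hφ : IsTest 0 1 φ) {x : ℝ}
    (hx : x ∈ Icc (0 : ℝ) 1) :
    ∫ t in Ioo 0 1, iteratedDeriv 2 φ t • greenVec x t = φ x := by
  rw [← hφ.integral_greenKernel hx]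
  exact integral_congr_ae ((greenVec_ae_eq x).mono fun t ht => by simp only [ht])

/-- The operator `a + c G² + r ⟨k, ·⟩ k` is onto, where `k` is Green's function with pole `x`. -/
theorem exists_green_equation {a c r : ℝ} (ha : 0 < a) (hc : 0 ≤ c) (hr : 0 ≤ r) {x : ℝ}
    (hx : x ∈ Icc (0 : ℝ) 1) (y : L2 0 1) :
    ∃ w : L2 0 1, (a : ℂ) • w + (c : ℂ) • greenCLM (greenCLM w)
      + ((r : ℂ) * green w x) • greenVec x = y := by
  set T : L2 0 1 →L[ℂ] L2 0 1 := (a : ℂ) • ContinuousLinearMap.id ℂ _ +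
    (c : ℂ) • (greenCLM ∘L greenCLM) +
    (r : ℂ) • (innerSL ℂ (greenVec x)).smulRight (greenVec x) with hT
  have hTw : ∀ w, T w = (a : ℂ) • w + (c : ℂ) • greenCLM (greenCLM w)
      + ((r : ℂ) * green w x) • greenVec x := fun w => by
    rw [mul_smul, ← inner_greenVec hx w]
    rfl
  have hu : IsUnit T := by
    refine ContinuousLinearMap.isUnit_of_forall_le_norm_inner_map T (c := ⟨a, ha.le⟩) ha
      fun w => ?_
    -- Coercivity in the sense of Lax–Milgram: self-adjointness of `G` makes the second term `c ‖G
    -- w‖²`, and the rank-one term gives `r |⟨k, w⟩|²`. The form is real and at least `a ‖w‖²`.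
    have e : inner ℂ w (T w) =
        ((a * ‖w‖ ^ 2 + c * ‖greenCLM w‖ ^ 2 + r * ‖green w x‖ ^ 2 : ℝ) : ℂ) := by
      rw [hTw, inner_add_right, inner_add_right, inner_smul_right, inner_smul_right,
        inner_smul_right, ← inner_greenCLM, inner_self_eq_norm_sq_to_K,
        inner_self_eq_norm_sq_to_K, ← inner_conj_symm w (greenVec x), inner_greenVec hx,
        mul_assoc, RCLike.mul_conj]
      push_cast
      rfl
    rw [norm_inner_symm, e, Complex.norm_real, Real.norm_eq_abs]
    refine le_trans ?_ (le_abs_self _)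
    have h1 : 0 ≤ c * ‖greenCLM w‖ ^ 2 := by positivity
    have h2 : 0 ≤ r * ‖green w x‖ ^ 2 := by positivity
    change ‖w‖ ^ 2 * a ≤ _
    linarith
  obtain ⟨w, hw⟩ := ((ContinuousLinearMap.isUnit_iff_bijective).1 hu).2 y
  exact ⟨w, (hTw w).symm.trans hw⟩

/-! ### Uniqueness for the Dirichlet problem and piecewise regularity -/

theorem greenCLM_injective : Function.Injective greenCLM := fun w z h => Lp.ext <|
  (isWeakDeriv_two_greenCLM w).unique (h ▸ isWeakDeriv_two_greenCLM z)
    (L2.integrableOn w) (L2.integrableOn z)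

/-- The difference of two solutions is affine and vanishes at both ends. The boundary values are
taken from representatives on `(0, ξ)` and `(ξ, 1)` because the domain prescribes `u_xx(0)` and
`u_xx(1)` through the two pieces separately. -/
theorem IsWeakDeriv.eq_greenCLM {f h : L2 0 1} (hf : IsWeakDeriv 0 1 2 f h) {ξ : ℝ}
    (hξ : ξ ∈ Ioo (0 : ℝ) 1) (h0 : HasValue 0 ξ f 0 0) (h1 : HasValue ξ 1 f 1 0) :
    f = greenCLM h := by
  have hG := isWeakDeriv_two_greenCLM h
  have hw : IsWeakDeriv 0 1 2 (fun x => f x + (-1 : ℂ) • greenCLM h x) fun _ => 0 := by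
    refine (hf.add (hG.smul (-1)) (L2.integrableOn f) ((L2.integrableOn _).smul (-1 : ℂ))
      (L2.integrableOn h) ((L2.integrableOn _).smul (-1 : ℂ))).congr_right (ae_of_all _ fun x => ?_)
    simp
  have e0 := h0.add (((hasValue_greenCLM h 0).mono le_rfl hξ.2.le).smul (-1))
  have e1 := h1.add (((hasValue_greenCLM h 1).mono hξ.1.le le_rfl).smul (-1))
  rw [green_zero, smul_zero, add_zero] at e0
  rw [green_one (L2.integrableOn h), smul_zero, add_zero] at e1
  refine Lp.ext ?_
  filter_upwards [ae_zero_of_weakDeriv_zero hξ.1 hξ.2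
    ((L2.integrableOn f).add ((L2.integrableOn _).smul (-1 : ℂ))) hw e0 e1] with x hx
  have hx' : f x + (-1 : ℂ) * greenCLM h x = 0 := hx
  linear_combination hx'

/-- On each side of `ξ` the function `u_xx` has this shape: the affine part comes from Green's
function with pole `ξ`, the rest from the potential of the load divided by `a`. -/
theorem isWeakDeriv_affine_add_green {g : ℝ → ℂ} (hg : IntegrableOn g (Ioo 0 1)) (A B r : ℂ) :
    IsWeakDeriv 0 1 1 (fun x => (A + x * B) + r • green g x) (fun x => B + r • greenSlope g x) := by
  have h := isWeakDeriv_primitive zero_le_one (g := fun _ => B) (by simp) A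
  simp only [intervalIntegral.integral_const, sub_zero, Complex.real_smul] at h
  exact h.add ((isWeakDeriv_green hg).smul r)
    (memLp_integrableOn (memLp_of_continuousOn (by fun_prop))) ((memLp_integrableOn
      (memLp_green hg)).smul r) (by simp) ((integrableOn_greenSlope hg).smul r)

theorem memH_affine_add_green {g : ℝ → ℂ} (hg : MemLp g 2 (volume.restrict (Ioo (0 : ℝ) 1)))
    (A B r : ℂ) : MemH 2 0 1 (fun x => (A + x * B) + r • green g x) := by
  have hi := memLp_integrableOn hg
  have hs : IsWeakDeriv 0 1 1 (fun x => B + r • greenSlope g x) (fun x => r • g x) := by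
    have h := isWeakDeriv_primitive zero_le_one (g := fun _ => 0) (by simp) B
    simp only [intervalIntegral.integral_zero, add_zero] at h
    have := h.add ((isWeakDeriv_greenSlope hi).smul r) (by simp)
      ((integrableOn_greenSlope hi).smul r) (by simp) (hi.smul r)
    simpa only [zero_add] using this
  exact (isWeakDeriv_affine_add_green hi A B r).memH_succ
    (memLp_of_continuousOn ((Continuous.continuousOn (by fun_prop)).add
      ((continuousOn_green hi).const_smul r)))
    (hs.memH_succ (memLp_of_continuousOn (continuousOn_const.add
      ((continuousOn_greenSlope hi).const_smul r))) (memH_zero (hg.const_smul r)))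

/-- Regularity on a subinterval where the second derivative is an explicit `H²` function. -/
theorem piecewise_regularity {c d : ℝ} (hc : 0 ≤ c) (hcd : c < d) (hd : d ≤ 1) {u w : ℝ → ℂ}
    (hu : MemH 2 0 1 u) (huw : IsWeakDeriv 0 1 2 u w) {g : ℝ → ℂ}
    (hg : MemLp g 2 (volume.restrict (Ioo (0 : ℝ) 1))) {A B r : ℂ}
    (hw : w =ᵐ[volume.restrict (Ioo c d)] fun x => (A + x * B) + r • green g x) :
    MemH 4 c d u ∧ ∀ x ∈ Icc c d,
      value c d (weakDeriv c d 2 u) x = (A + x * B) + r • green g x ∧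
      value c d (weakDeriv c d 3 u) x = B + r • greenSlope g x := by
  have hi := memLp_integrableOn hg
  have hsub := Icc_subset_Icc hc hd
  have c2 : ContinuousOn (fun x : ℝ => (A + x * B) + r • green g x) (Icc c d) :=
    (Continuous.continuousOn (by fun_prop)).add (((continuousOn_green hi).mono hsub).const_smul r)
  have c3 : ContinuousOn (fun x : ℝ => B + r • greenSlope g x) (Icc c d) :=
    continuousOn_const.add (((continuousOn_greenSlope hi).mono hsub).const_smul r)
  have h2 := (huw.mono hc hd).congr_right hw
  have h3 := h2.trans ((isWeakDeriv_affine_add_green hi A B r).mono hc hd)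
  exact ⟨(hu.mono hc hd).extend ((memH_affine_add_green hg A B r).mono hc hd) h2, fun x hx =>
    ⟨value_of_continuousOn hcd hx c2 (h2.weakDeriv_ae_eq (memLp_of_continuousOn c2)),
      value_of_continuousOn hcd hx c3 (h3.weakDeriv_ae_eq (memLp_of_continuousOn c3))⟩⟩

/-! ### The bending moment and the dissipation identity -/

namespace Params

variable {p : Params}

theorem ξ_mem_Icc (p : Params) : p.ξ ∈ Icc (0 : ℝ) 1 := Ioo_subset_Icc_self p.ξ_mem

/-- Uniqueness for the Dirichlet problem. Applied to the velocity, it gives `v = G v_xx` and hence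
`v(ξ) = ⟨k, v_xx⟩`. -/
theorem Disp.toL2_eq_greenCLM (u : p.Disp) : u.toL2 = greenCLM u.dxx := by
  have hv : ∀ x ∈ Icc (0 : ℝ) 1, HasValue 0 1 u.toL2 x (value 0 1 u.toL2 x) := fun x hx =>
    u.memH.hasValue zero_lt_one (by norm_num) hx
  have h0 := hv 0 (by simp)
  have h1 := hv 1 (by simp)
  rw [u.value_zero] at h0
  rw [u.value_one] at h1
  exact (u.memH.isWeakDeriv le_rfl).eq_greenCLM p.ξ_mem (h0.mono le_rfl p.ξ_mem.2.le)
    (h1.mono p.ξ_mem.1.le le_rfl)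

/-- The bending moment of an element of the domain, through Green's operator. -/
theorem moment_eq (U : p.domain) :
    (p.a : ℂ) • weakDeriv 0 1 2 U.1.u + ((p.α : ℂ) * value 0 1 U.1.v p.ξ) • greenVec p.ξ =
      greenCLM (-(accel U + (p.b : ℂ) • U.1.v)) := by
  set V := (p.α : ℂ) * value 0 1 U.1.v p.ξ with hV
  have hξ := p.ξ_mem
  have hu2 : IsWeakDeriv 0 1 2 U.1.u (weakDeriv 0 1 2 U.1.u) :=
    (Energy.memH_u U.1).isWeakDeriv le_rfl
  have hcoe : ((p.a : ℂ) • weakDeriv 0 1 2 U.1.u + V • greenVec p.ξ : L2 0 1)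
      =ᵐ[volume.restrict (Ioo 0 1)]
        fun x => (p.a : ℂ) • weakDeriv 0 1 2 U.1.u x + V • greenVec p.ξ x := by
    filter_upwards [Lp.coeFn_add ((p.a : ℂ) • weakDeriv 0 1 2 U.1.u) (V • greenVec p.ξ),
      Lp.coeFn_smul (p.a : ℂ) (weakDeriv 0 1 2 U.1.u), Lp.coeFn_smul V (greenVec p.ξ)]
      with x h1 h2 h3
    rw [h1, Pi.add_apply, h2, h3]
    rfl
  have hz : ∀ x, greenKernel p.ξ x = 0 → HasValue 0 1 (greenVec p.ξ) x 0 := fun x hx => by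
    have := hasValue_greenVec p.ξ x
    rwa [hx, Complex.ofReal_zero] at this
  refine IsWeakDeriv.eq_greenCLM ?_ hξ ?_ ?_
  -- Testing against `φ''` gives `a ∫ φ'''' u + α v(ξ) φ(ξ)`, and the definition of the acceleration
  -- turns this into `-∫ φ (g + b v)`. The jump conditions at `ξ` enter only through the existence
  -- of that acceleration.
  · intro φ hφ
    have e := isAccel_accel U φ hφ
    have e4 := hu2 _ (hφ.test_iteratedDeriv 2)
    have e4' : iteratedDeriv 2 (iteratedDeriv 2 φ) = iteratedDeriv 4 φ := by
      simp only [iteratedDeriv_eq_iterate, ← Function.iterate_add_apply]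
    rw [e4', neg_one_sq, one_mul] at e4
    have hφ2 := hφ.test_iteratedDeriv 2
    have i1 : Integrable (fun x => (p.a : ℂ) * iteratedDeriv 2 φ x • weakDeriv 0 1 2 U.1.u x)
        (volume.restrict (Ioo 0 1)) := (hφ2.integrable_smul (L2.integrableOn _)).const_mul _
    have i2 : Integrable (fun x => V * iteratedDeriv 2 φ x • greenVec p.ξ x)
        (volume.restrict (Ioo 0 1)) := (hφ2.integrable_smul (L2.integrableOn _)).const_mul _
    have i3 := hφ.integrable_smul (L2.integrableOn (accel U))
    have i4 : Integrable (fun x => (p.b : ℂ) * φ x • U.1.v x)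
        (volume.restrict (Ioo 0 1)) := (hφ.integrable_smul (L2.integrableOn _)).const_mul _
    have eL : ∫ x in Ioo 0 1, iteratedDeriv 2 φ x •
        ((p.a : ℂ) • weakDeriv 0 1 2 U.1.u + V • greenVec p.ξ : L2 0 1) x =
        p.a * (∫ x in Ioo 0 1, iteratedDeriv 2 φ x • weakDeriv 0 1 2 U.1.u x) + V * φ p.ξ := by
      rw [← hφ.integral_greenVec p.ξ_mem_Icc, ← integral_const_mul, ← integral_const_mul,
        ← integral_add i1 i2]
      refine integral_congr_ae (hcoe.mono fun x hx => ?_)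
      simp only [hx, Complex.real_smul, smul_eq_mul]
      ring
    have eR : ∫ x in Ioo 0 1, φ x • (-(accel U + (p.b : ℂ) • U.1.v) : L2 0 1) x =
        -((∫ x in Ioo 0 1, φ x • accel U x) + p.b * ∫ x in Ioo 0 1, φ x • U.1.v x) := by
      rw [← integral_const_mul, ← integral_add i3 i4, ← integral_neg]
      refine integral_congr_ae ?_
      filter_upwards [Lp.coeFn_neg (accel U + (p.b : ℂ) • U.1.v),
        Lp.coeFn_add (accel U) ((p.b : ℂ) • U.1.v), Lp.coeFn_smul (p.b : ℂ) U.1.v] with x h1 h2 h3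
      rw [h1, Pi.neg_apply, h2, Pi.add_apply, h3, Pi.smul_apply]
      simp only [Complex.real_smul, smul_eq_mul]
      ring
    rw [eL, eR, e, e4, hV]
    simp only [Complex.real_smul]
    ring
  -- Both summands vanish at `0`: `u_xx` by the boundary condition, carried over from the derivative
  -- on `(0, ξ)`, and the kernel by its formula. The endpoint `1` is symmetric.
  · have l2 := ((hu2.mono le_rfl hξ.2.le).weakDeriv_ae_eq ((Lp.memLp _).mono_measure
      (Measure.restrict_mono (Ioo_subset_Ioo le_rfl hξ.2.le) le_rfl)))
    have h0 := U.2.left.hasValue_weakDeriv (k := 2) hξ.1 (by norm_num) ⟨le_rfl, hξ.1.le⟩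
    rw [U.2.uxx_zero] at h0
    have h1 := ((h0.congr l2).smul (p.a : ℂ)).add
      (((hz 0 (by simp [greenKernel, hξ.1.le])).mono le_rfl hξ.2.le).smul V)
    simp only [smul_zero, add_zero] at h1
    exact h1.congr (p.ae_restrict_left hcoe.symm)
  · have r2 := ((hu2.mono hξ.1.le le_rfl).weakDeriv_ae_eq ((Lp.memLp _).mono_measure
      (Measure.restrict_mono (Ioo_subset_Ioo hξ.1.le le_rfl) le_rfl)))
    have h0 := U.2.right.hasValue_weakDeriv (k := 2) hξ.2 (by norm_num) ⟨hξ.2.le, le_rfl⟩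
    rw [U.2.uxx_one] at h0
    have h1 := ((h0.congr r2).smul (p.a : ℂ)).add
      (((hz 1 (by simp [greenKernel, hξ.2.le])).mono hξ.1.le le_rfl).smul V)
    simp only [smul_zero, add_zero] at h1
    exact h1.congr (p.ae_restrict_right hcoe.symm)

/-- The dissipation identity. -/
theorem re_inner_operator (U : p.operator.domain) :
    (inner ℂ (U : p.Energy) (p.operator U)).re =
      -p.b * ‖(U : p.Energy).v‖ ^ 2 - p.α * ‖value 0 1 (U : p.Energy).v p.ξ‖ ^ 2 := by
  let U' : p.domain := U
  set g : L2 0 1 := accel U' with hg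
  set v : L2 0 1 := U'.1.v with hv
  set w : L2 0 1 := weakDeriv 0 1 2 U'.1.u with hw
  set V := value 0 1 v p.ξ with hV
  have e1 : inner ℂ (U : p.Energy) (p.operator U) =
      (p.a : ℂ) * inner ℂ w (velocity U').dxx + inner ℂ v g := rfl
  have e2 : v = greenCLM (velocity U').dxx := Disp.toL2_eq_greenCLM (velocity U')
  have e3 : (p.a : ℂ) • w = greenCLM (-(g + (p.b : ℂ) • v)) - ((p.α : ℂ) * V) • greenVec p.ξ :=
    eq_sub_of_add_eq (moment_eq U')
  have e4 : inner ℂ (greenVec p.ξ) (velocity U').dxx = V := by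
    rw [inner_greenVec p.ξ_mem_Icc, hV, e2, value_greenCLM _ p.ξ_mem_Icc]
  have e5 : (p.a : ℂ) * inner ℂ w (velocity U').dxx = inner ℂ ((p.a : ℂ) • w) (velocity U').dxx := by
    rw [inner_smul_left, Complex.conj_ofReal]
  -- Moving `G` onto `v_xx` reproduces `v`, and pairing `k` with `v_xx` reproduces `v(ξ)`; this
  -- replaces two integrations by parts with jump terms.
  rw [e1, e5, e3, inner_sub_left, inner_greenCLM, ← e2, inner_neg_left, inner_add_left,
    inner_smul_left, inner_smul_left, e4, map_mul, Complex.conj_ofReal, Complex.conj_ofReal,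
    inner_self_eq_norm_sq_to_K, mul_assoc, RCLike.conj_mul]
  -- The two remaining terms in `g` are conjugate up to sign, so they cancel only in the real part.
  have e6 : (inner ℂ g v).re = (inner ℂ v g).re := by
    rw [← inner_conj_symm g v, Complex.conj_re]
  change _ = -p.b * ‖v‖ ^ 2 - p.α * ‖V‖ ^ 2
  simp only [Complex.add_re, Complex.sub_re, Complex.neg_re, e6, Complex.coe_algebraMap,
    ← Complex.ofReal_pow, ← Complex.ofReal_mul, Complex.ofReal_re]
  ring

/-- The pair of a displacement given by its second derivative `w` and a velocity `V` is in the
domain if `a w` is a bending moment with a shear jump `-α V(ξ)` at `ξ`. -/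
theorem inDomain_of_moment {w q : L2 0 1} {V : p.Disp}
    (hw : (p.a : ℂ) • w + ((p.α : ℂ) * value 0 1 V.toL2 p.ξ) • greenVec p.ξ = greenCLM q) :
    p.InDomain (greenCLM w) V.toL2 := by
  have hξ := p.ξ_mem
  have ha : (p.a : ℂ) ≠ 0 := by exact_mod_cast p.a_pos.ne'
  set s : ℂ := ((p.α / p.a : ℝ) : ℂ) * value 0 1 V.toL2 p.ξ with hs
  have hae : w =ᵐ[volume.restrict (Ioo 0 1)]
      fun x => (p.a : ℂ)⁻¹ • green q x - s * greenKernel p.ξ x := by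
    have e : w = (p.a : ℂ)⁻¹ • greenCLM q - s • greenVec p.ξ := by
      rw [← hw, smul_add, smul_smul, smul_smul, inv_mul_cancel₀ ha, one_smul, hs]
      have : (p.a : ℂ)⁻¹ * (p.α * value 0 1 V.toL2 p.ξ) =
          ((p.α / p.a : ℝ) : ℂ) * value 0 1 V.toL2 p.ξ := by
        push_cast; ring
      rw [this, add_sub_cancel_right]
    have h : ((p.a : ℂ)⁻¹ • greenCLM q - s • greenVec p.ξ : L2 0 1)
        =ᵐ[volume.restrict (Ioo 0 1)]
          fun x => (p.a : ℂ)⁻¹ • green q x - s * greenKernel p.ξ x := by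
      filter_upwards [Lp.coeFn_sub ((p.a : ℂ)⁻¹ • greenCLM q) (s • greenVec p.ξ),
        Lp.coeFn_smul (p.a : ℂ)⁻¹ (greenCLM q), Lp.coeFn_smul s (greenVec p.ξ),
        greenCLM_ae_eq q, greenVec_ae_eq p.ξ] with x h1 h2 h3 h4 h5
      rw [h1, Pi.sub_apply, h2, h3, Pi.smul_apply, Pi.smul_apply, h4, h5, smul_eq_mul s]
    rwa [← e] at h
  -- For `x < ξ` the kernel is `(ξ - 1) x`, which gives `A` and `B`.
  obtain ⟨hL, hL'⟩ := piecewise_regularity (c := 0) (d := p.ξ) le_rfl hξ.1 hξ.2.le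
    (memH_greenCLM w) (isWeakDeriv_two_greenCLM w) (Lp.memLp q) (A := 0) (B := -(s * (p.ξ - 1)))
    (r := (p.a : ℂ)⁻¹) (by
      filter_upwards [p.ae_restrict_left hae, ae_restrict_mem measurableSet_Ioo] with x hx hm
      rw [hx, greenKernel, min_eq_right hm.2.le]
      push_cast
      ring)
  -- For `x > ξ` the kernel is `ξ x - ξ`.
  obtain ⟨hR, hR'⟩ := piecewise_regularity (c := p.ξ) (d := 1) hξ.1.le hξ.2 le_rfl
    (memH_greenCLM w) (isWeakDeriv_two_greenCLM w) (Lp.memLp q) (A := s * p.ξ) (B := -(s * p.ξ))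
    (r := (p.a : ℂ)⁻¹) (by
      filter_upwards [p.ae_restrict_right hae, ae_restrict_mem measurableSet_Ioo] with x hx hm
      rw [hx, greenKernel, min_eq_left hm.1.le]
      push_cast
      ring)
  refine ⟨hL, hR, V.memH, V.value_zero, V.value_one, ?_, ?_, ?_, ?_⟩
  · rw [(hL' 0 ⟨le_rfl, hξ.1.le⟩).1, green_zero]
    simp
  · rw [(hR' 1 ⟨hξ.2.le, le_rfl⟩).1, green_one (L2.integrableOn q)]
    simp
  · rw [(hL' p.ξ ⟨hξ.1.le, le_rfl⟩).1, (hR' p.ξ ⟨le_rfl, hξ.2.le⟩).1]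
    ring
  -- The Green slopes are continuous at `ξ` and cancel. The affine slopes `-s ξ` and `-s (ξ - 1)`
  -- differ by `-s`, the required shear jump.
  · rw [(hL' p.ξ ⟨hξ.1.le, le_rfl⟩).2, (hR' p.ξ ⟨le_rfl, hξ.2.le⟩).2, neg_mul, ← hs]
    ring

/-! ### The resolvent equation -/

/-- The displacement with prescribed second derivative. -/
def Disp.ofDxx (p : Params) (w : L2 0 1) : p.Disp :=
  ⟨greenCLM w, memH_greenCLM w, by rw [value_greenCLM w (by simp), green_zero],
    by rw [value_greenCLM w (by simp), green_one (L2.integrableOn w)]⟩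

theorem Disp.toL2_ofDxx (w : L2 0 1) : (Disp.ofDxx p w).toL2 = greenCLM w := rfl

/-- The resolvent equation `l U - 𝒜 U = F` is solvable for every `l ≥ 0`. -/
theorem exists_resolvent {l : ℝ} (hl : 0 ≤ l) (F : p.Energy) :
    ∃ U : p.operator.domain, (l : ℂ) • (U : p.Energy) - p.operator U = F := by
  set f : p.Disp := F.fst with hf
  set g : L2 0 1 := F.v with hg
  -- The coefficients and the right-hand side come from inserting `u = G w`, `v = l u - f` and
  -- acceleration `l v - g` into the moment identity.
  obtain ⟨w, hw⟩ := exists_green_equation (c := l * (l + p.b)) (r := p.α * l) p.a_pos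
    (mul_nonneg hl (add_nonneg hl p.b_pos.le)) (mul_nonneg p.α_pos.le hl) p.ξ_mem_Icc
    (greenCLM (g + ((l + p.b : ℝ) : ℂ) • f.toL2) +
      ((p.α : ℂ) * value 0 1 f.toL2 p.ξ) • greenVec p.ξ)
  set V : p.Disp := (l : ℂ) • Disp.ofDxx p w - f with hV
  have hVL : V.toL2 = (l : ℂ) • greenCLM w - f.toL2 := by
    rw [hV, map_sub, map_smul, Disp.toL2_ofDxx]
  have hVξ : value 0 1 V.toL2 p.ξ = l * green w p.ξ - value 0 1 f.toL2 p.ξ := by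
    have h := ((hasValue_greenCLM w p.ξ).smul (l : ℂ)).add
      ((f.memH.hasValue zero_lt_one (by norm_num) p.ξ_mem_Icc).smul (-1))
    have hae : (fun x => (l : ℂ) • greenCLM w x + (-1 : ℂ) • f.toL2 x)
        =ᵐ[volume.restrict (Ioo 0 1)] V.toL2 := by
      rw [hVL]
      filter_upwards [Lp.coeFn_sub ((l : ℂ) • greenCLM w) f.toL2,
        Lp.coeFn_smul (l : ℂ) (greenCLM w)] with x h1 h2
      rw [h1, Pi.sub_apply, h2, Pi.smul_apply]
      simp [sub_eq_add_neg]
    rw [(h.congr hae).value_eq zero_lt_one p.ξ_mem_Icc]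
    simp only [smul_eq_mul]
    ring
  -- This is `-(acceleration + b v)` for the acceleration `l v - g` demanded by the second
  -- component.
  set q : L2 0 1 := g - ((l + p.b : ℝ) : ℂ) • V.toL2 with hq
  have hmom : (p.a : ℂ) • w + ((p.α : ℂ) * value 0 1 V.toL2 p.ξ) • greenVec p.ξ = greenCLM q := by
    rw [hVξ, hq, hVL]
    simp only [map_sub, map_add, map_smul] at hw ⊢
    push_cast at hw ⊢
    linear_combination (norm := module) hw
  let U : p.domain := ⟨WithLp.toLp 2 (Disp.ofDxx p w, V.toL2), inDomain_of_moment hmom⟩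
  have hacc : accel U = (l : ℂ) • V.toL2 - g := by
    have h1 := moment_eq U
    have h2 : weakDeriv 0 1 2 U.1.u = w := (isWeakDeriv_two_greenCLM w).weakDeriv_eq
    rw [h2] at h1
    -- The actual acceleration satisfies the same moment identity, so injectivity of `G` identifies
    -- it without computing any fourth derivative.
    have h3 : q = -(accel U + (p.b : ℂ) • V.toL2) := greenCLM_injective (hmom.symm.trans h1)
    rw [hq] at h3
    push_cast at h3
    linear_combination (norm := module) h3
  refine ⟨U, ?_⟩
  have hA : p.operator U = WithLp.toLp 2 (V, accel U) := rfl
  rw [hA, hacc]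
  have hF : F = WithLp.toLp 2 (f, g) := rfl
  have hU : (U : p.Energy) = WithLp.toLp 2 (Disp.ofDxx p w, V.toL2) := rfl
  rw [hF, hU, ← WithLp.toLp_smul, ← WithLp.toLp_sub, Prod.smul_mk, Prod.mk_sub_mk, hV,
    sub_sub_cancel, sub_sub_cancel]

end Params

end Beam

end

theorem mainTheorem8 (p : Beam.Params) :
    p.operator.IsMDissipative ∧
    (∀ U : p.operator.domain,
      (inner ℂ (U : p.Energy) (p.operator U)).re =
        -p.b * ‖(U : p.Energy).v‖ ^ 2 - p.α * ‖Beam.value 0 1 (U : p.Energy).v p.ξ‖ ^ 2) ∧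
    Function.Surjective (fun U : p.operator.domain => -p.operator U) := by
  refine ⟨⟨fun U => ?_, fun μ hμ F => Beam.Params.exists_resolvent hμ.le F⟩,
    Beam.Params.re_inner_operator, fun F => ?_⟩
  · rw [Beam.Params.re_inner_operator U]
    have h1 := mul_nonneg p.b_pos.le (sq_nonneg ‖(U : p.Energy).v‖)
    have h2 := mul_nonneg p.α_pos.le (sq_nonneg ‖Beam.value 0 1 (U : p.Energy).v p.ξ‖)
    linarith
  -- The resolvent equation at `l = 0`.
  · obtain ⟨U, hU⟩ := Beam.Params.exists_resolvent le_rfl F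
    exact ⟨U, by simpa using hU⟩
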